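/- Let $\nu>0$, let $n\in\{1,2\}$, and let functions be complex-valued (real-valued functions being a special case). For $u_0\in H^1(\mathbb{R}^n)$ and $u_1\in L^1(\mathbb{R}^n)\cap L^2(\mathbb{R}^n)$ let $u\in C([0,\infty);H^1(\mathbb{R}^n))\cap C^1([0,\infty);L^2(\mathbb{R}^n))$ be the solution, in the sense of distributions, of the strongly damped wave equation $$\partial_t^2u-\Delta u-\nu\Delta\partial_tu=0\quad(t>0,\ x\in\mathbb{R}^n),\qquad u(0,\cdot)=u_0,\quad \partial_tu(0,\cdot)=u_1 .$$ Let $W(t)g:=\mathcal F^{-1}\!\left[\frac{\sin(t|\xi|)}{|\xi|}\,\widehat g(\xi)\right]$ for $g\in L^2(\mathbb{R}^n)$ be the solution operator of the free wave equation with initial data $(0,g)$, and put $m_1:=\int_{\mathbb{R}^n}u_1(x)\,dx$. (i) Let $n=1$. There is a constant $C>0$, depending only on $\nu$, such that for all such $u_0,u_1$ and all $t\ge 2$, $$\|u(t)-W(t)u_1\|_{L^2}\le C\|u_0\|_{L^2}+C\,t^{1/4}\|u_1\|_{L^1}+C\|u_1\|_{L^2}.$$ (ii) Let $n=2$. There are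 constants $c,C>0$, depending only on $\nu$, such that for all such $u_0,u_1$ with $m_1\neq0$ there is a $T\ge2$ with $$c\,|m_1|\sqrt{\log t}\le\|u(t)-W(t)u_1\|_{L^2}\le C\|u_0\|_{L^2}+C\sqrt{\log t}\,\|u_1\|_{L^1}+C\|u_1\|_{L^2}\qquad\text{for all }t\ge T.$$ -/

import Mathlib

open MeasureTheory Filter Topology
open scoped FourierTransform SchwartzMap Laplacian

noncomputable section

namespace StronglyDampedWave

/-- The space `ℝⁿ` with its Euclidean norm. -/
abbrev Space (n : ℕ) : Type := EuclideanSpace ℝ (Fin n)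

/-- The space `L²(ℝⁿ)` of complex-valued functions (real-valued functions are a special case). -/
abbrev L2 (n : ℕ) : Type := Lp ℂ 2 (volume : Measure (Space n))

/-- An `L²` function viewed as a tempered distribution. -/
abbrev distr {n : ℕ} (f : L2 n) : 𝓢'(Space n, ℂ) := Lp.toTemperedDistribution f

/-- `f ∈ H¹(ℝⁿ)`. -/
def MemH1 {n : ℕ} (f : L2 n) : Prop :=
  TemperedDistribution.MemSobolev 1 2 (distr f)

/-- `u ∈ C([0,∞); H¹(ℝⁿ))`. The Bessel potential of order one (the Fourier multiplier
`(1 + ‖ξ‖²)^(1/2)`) identifies `H¹` with `L²`, so this asks that the image of `u` under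
this identification is a continuous curve in `L²`. -/
def ContinuousInH1 {n : ℕ} (u : ℝ → L2 n) : Prop :=
  ∃ w : ℝ → L2 n, ContinuousOn w (Set.Ici 0) ∧
    ∀ t : ℝ, 0 ≤ t →
      TemperedDistribution.besselPotential (Space n) ℂ 1 (distr (u t)) = distr (w t)

/-- `u` is a solution in the class `C([0,∞); H¹(ℝⁿ)) ∩ C¹([0,∞); L²(ℝⁿ))` of
`∂ₜ²u - Δu - ν Δ∂ₜu = 0`, `u(0) = u₀`, `∂ₜu(0) = u₁`. Here `v` is the derivative `∂ₜu`
in `L²` (one-sided at `t = 0`), and the equation `∂ₜv = Δu + ν Δv` holds in the sense of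
distributions: tested against every Schwartz function of the space variable, for every `t > 0`.
Only the values of `u` and `v` at times `t ≥ 0` matter. -/
def IsSolution {n : ℕ} (ν : ℝ) (u₀ u₁ : L2 n) (u : ℝ → L2 n) : Prop :=
  ContinuousInH1 u ∧
  ∃ v : ℝ → L2 n,
    ContinuousOn v (Set.Ici 0) ∧
    (∀ t : ℝ, 0 ≤ t → HasDerivWithinAt u (v t) (Set.Ici 0) t) ∧
    u 0 = u₀ ∧ v 0 = u₁ ∧
    ∀ φ : 𝓢(Space n, ℂ), ∀ t : ℝ, 0 < t →
      HasDerivAt (fun s : ℝ => distr (v s) φ)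
        ((Δ (distr (u t))) φ + (ν : ℂ) * (Δ (distr (v t))) φ) t

/-- The symbol `ω(t,ξ) = sin(t|ξ|)/|ξ|`. With the normalization
`𝓕 g (x) = ∫ exp(-2πi⟪y, x⟫) g(y) dy` of the Fourier transform, the frequency variable is
`ξ = 2πx`. (The value at the single point `x = 0` is irrelevant in positive dimension.) -/
def waveSymbol {n : ℕ} (t : ℝ) (x : Space n) : ℝ :=
  Real.sin (t * (2 * Real.pi * ‖x‖)) / (2 * Real.pi * ‖x‖)

theorem abs_waveSymbol_le {n : ℕ} (t : ℝ) (x : Space n) : |waveSymbol t x| ≤ |t| := by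
  unfold waveSymbol
  rcases eq_or_ne ‖x‖ 0 with h | h
  · simp [h]
  · have hpos : 0 < 2 * Real.pi * ‖x‖ := by
      have : 0 < ‖x‖ := lt_of_le_of_ne (norm_nonneg x) h.symm
      positivity
    rw [abs_div, abs_of_pos hpos, div_le_iff₀ hpos]
    calc |Real.sin (t * (2 * Real.pi * ‖x‖))| ≤ |t * (2 * Real.pi * ‖x‖)| := Real.abs_sin_le_abs
      _ = |t| * (2 * Real.pi * ‖x‖) := by rw [abs_mul, abs_of_pos hpos]

theorem measurable_waveSymbol {n : ℕ} (t : ℝ) : Measurable (waveSymbol (n := n) t) := by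
  unfold waveSymbol
  fun_prop

theorem memLp_waveSymbol_mul {n : ℕ} (t : ℝ) (g : L2 n) :
    MemLp (fun x : Space n => (waveSymbol t x : ℂ) * g x) 2 volume := by
  refine MemLp.of_le_mul (c := |t|) (Lp.memLp g) ?_ ?_
  · exact (Complex.measurable_ofReal.comp (measurable_waveSymbol t)).aestronglyMeasurable.mul
      (Lp.memLp g).1
  · refine Eventually.of_forall fun x => ?_
    rw [norm_mul, Complex.norm_real, Real.norm_eq_abs]
    exact mul_le_mul_of_nonneg_right (abs_waveSymbol_le t x) (norm_nonneg _)

/-- The free wave evolution `W(t)g = 𝓕⁻¹[ω(t,·) 𝓕 g]` on `L²(ℝⁿ)`, with the Fourier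
transform of `L²` (the Plancherel extension). -/
def freeWave {n : ℕ} (t : ℝ) (g : L2 n) : L2 n :=
  𝓕⁻ ((memLp_waveSymbol_mul t (𝓕 g)).toLp (fun x : Space n => (waveSymbol t x : ℂ) * (𝓕 g) x))

end StronglyDampedWave

end

/-! At angular frequency `r = 2π‖x‖` the equation is the damped oscillator `û'' + ν r² û' + r² û =
0`, so `û(t) = E₁ û₁ + E₀ û₀` with explicit propagators. Here `E₀` is bounded by 3 for every `r` and
`t ≥ 0`. For small `r`, `E₁` is close to `exp(-ν r² t / 2) sin(t r) / r`, and for large `r` both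
`E₁` and `sin(t r) / r` are bounded. Hence `E₁ - sin(t r) / r + lowKernel` is bounded by `3ν`, where
`lowKernel` is `(1 - exp(-ν r² t / 2)) sin(t r) / r` cut off at `ν r ≤ 1`. By Plancherel, `‖u(t) -
W(t)u₁‖` equals the `L²` norm of `lowKernel · û₁` up to `3‖u₀‖ + 3ν‖u₁‖`
(`IsSolution.abs_norm_sub_freeWave_sub_le`).

It remains to measure the kernel. It is negligible for `r ≪ t^(-1/2)` and behaves like `sin(t r) /
r` above that scale, so its squared `L²` norm is of order at most `√t` for `n = 1` and of order `log
t` for `n = 2`. The upper bounds follow from `|û₁| ≤ ‖u₁‖_{L¹}`. For the lower bound, `û₁` is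
continuous with `û₁(0) = m₁`, so `|û₁| ≥ |m₁| / 2` near the origin, where the logarithm is produced;
for large `t` it beats the bounded data terms.

The formula for `û` must come from the weak formulation. Integrating in time gives an a.e. identity
in frequency at each fixed `t`. On frequency balls, where the characteristic roots are bounded, it
becomes a linear ODE in `L²` with a bounded generator, solved by uniqueness
(`IsSolution.fourier_first_order`). -/

noncomputable section

namespace StronglyDampedWave

variable {n : ℕ}

/-! ### The weak equation on the Fourier side -/

/-- Evaluation of the distribution of an `L²` function against a fixed Schwartz function. -/
def pairing (φ : 𝓢(Space n, ℂ)) : L2 n →L[ℂ] ℂ :=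
  (PointwiseConvergenceCLM.evalCLM (RingHom.id ℂ) ℂ φ) ∘L Lp.toTemperedDistributionCLM ℂ volume 2

theorem pairing_apply (φ : 𝓢(Space n, ℂ)) (f : L2 n) : pairing φ f = distr f φ := rfl

theorem distr_fourier (f : L2 n) (ψ : 𝓢(Space n, ℂ)) :
    distr f (𝓕 ψ) = ∫ x, ψ x • (𝓕 f : L2 n) x := by
  rw [← Lp.toTemperedDistribution_apply, ← Lp.fourier_toTemperedDistribution_eq,
    TemperedDistribution.fourier_apply]

theorem distr_laplacian_fourier (f : L2 n) (ψ : 𝓢(Space n, ℂ)) :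
    distr f (Δ (𝓕 ψ)) =
      ∫ x, ψ x • ((-(2 * Real.pi * ‖x‖) ^ 2 : ℝ) : ℂ) * (𝓕 f : L2 n) x := by
  rw [← TemperedDistribution.laplacian_apply_apply,
    TemperedDistribution.laplacian_eq_fourierMultiplierCLM]
  have h : TemperedDistribution.fourierMultiplierCLM ℂ
      (fun x : Space n ↦ Complex.ofReal (‖x‖ ^ 2)) (distr f) (𝓕 ψ) =
      ∫ x, (((‖x‖ ^ 2 : ℝ) : ℂ) * ψ x) * (𝓕 f : L2 n) x := by
    rw [TemperedDistribution.fourierMultiplierCLM_apply_apply, distr_fourier,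
      FourierTransform.fourierInv_fourier_eq]
    refine integral_congr_ae (Eventually.of_forall fun x => ?_)
    simp only []
    rw [SchwartzMap.smulLeftCLM_apply_apply (by fun_prop)]
    simp [smul_eq_mul]
  rw [smul_apply, h, ← Complex.coe_smul, smul_eq_mul, ← integral_const_mul]
  refine integral_congr_ae (Eventually.of_forall fun x => ?_)
  simp only [smul_eq_mul]
  push_cast
  ring

theorem locallyIntegrable_continuous_mul (g : Space n → ℂ) (hg : Continuous g) (f : L2 n) :
    LocallyIntegrable (fun x => g x * f x) volume := by
  have hf : LocallyIntegrable f volume := (Lp.memLp f).locallyIntegrable (by norm_num)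
  exact hf.continuous_mul hg

/-- Test functions of the form `𝓕 ψ`, with `ψ` smooth and compactly supported, already separate
locally integrable functions on the frequency side. -/
theorem ae_eq_of_pairing_fourier (f g : L2 n)
    (h : ∀ φ : 𝓢(Space n, ℂ), distr f φ = distr g (Δ φ)) :
    ∀ᵐ x : Space n,
      (𝓕 f : L2 n) x = ((-(2 * Real.pi * ‖x‖) ^ 2 : ℝ) : ℂ) * (𝓕 g : L2 n) x := by
  apply ae_eq_of_integral_contDiff_smul_eq
  · exact (Lp.memLp _).locallyIntegrable (by norm_num)
  · exact locallyIntegrable_continuous_mul _ (by fun_prop) _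
  · intro ψ hψ hψc
    have hg₁ : HasCompactSupport (Complex.ofRealCLM ∘ ψ) := hψc.comp_left rfl
    have hg₂ : ContDiff ℝ ((⊤ : ℕ∞) : WithTop ℕ∞) (Complex.ofRealCLM ∘ ψ) := by fun_prop
    have := h (𝓕 (hg₁.toSchwartzMap hg₂))
    rw [distr_fourier, distr_laplacian_fourier] at this
    simpa [mul_assoc] using this

/-- The time primitive of a curve in `L²` that vanishes at `t = 0`; the curve is frozen at
negative times. -/
def primitive (u : ℝ → L2 n) (t : ℝ) : L2 n := ∫ s in (0 : ℝ)..t, u (max s 0)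

theorem continuous_comp_max {u : ℝ → L2 n} (hu : ContinuousOn u (Set.Ici 0)) :
    Continuous fun s : ℝ => u (max s 0) :=
  hu.comp_continuous (by fun_prop) fun s => Set.mem_Ici.2 (le_max_right s 0)

theorem hasDerivAt_primitive {u : ℝ → L2 n} (hu : ContinuousOn u (Set.Ici 0)) {t : ℝ}
    (ht : 0 ≤ t) : HasDerivAt (primitive u) (u t) t := by
  have := intervalIntegral.integral_hasDerivAt_right
    ((continuous_comp_max hu).intervalIntegrable 0 t)
    ((continuous_comp_max hu).stronglyMeasurableAtFilter _ _)
    (continuous_comp_max hu).continuousAt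
  rwa [max_eq_left ht] at this

/-- Integrating the weak equation in time removes the derivative of `v`, which exists only after
pairing with Schwartz functions, and leaves an identity at a fixed time that can be read off a.e. in
frequency. -/
theorem IsSolution.fourier_eq {ν : ℝ} {u₀ u₁ : L2 n} {u v : ℝ → L2 n}
    (hv : ContinuousOn v (Set.Ici 0))
    (huv : ∀ t : ℝ, 0 ≤ t → HasDerivWithinAt u (v t) (Set.Ici 0) t)
    (hu0 : u 0 = u₀) (hv0 : v 0 = u₁)
    (heq : ∀ φ : 𝓢(Space n, ℂ), ∀ t : ℝ, 0 < t →
      HasDerivAt (fun s : ℝ => distr (v s) φ)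
        ((Δ (distr (u t))) φ + (ν : ℂ) * (Δ (distr (v t))) φ) t) {t : ℝ} (ht : 0 ≤ t) :
    ∀ᵐ x : Space n, (𝓕 (v t - u₁) : L2 n) x = ((-(2 * Real.pi * ‖x‖) ^ 2 : ℝ) : ℂ) *
      (𝓕 (primitive u t + (ν : ℂ) • (u t - u₀)) : L2 n) x := by
  apply ae_eq_of_pairing_fourier
  intro φ
  have hu : ContinuousOn u (Set.Ici 0) := fun s hs => (huv s hs).continuousWithinAt
  have hU : ContinuousOn (primitive u) (Set.Ici 0) :=
    fun s hs => (hasDerivAt_primitive hu hs).continuousAt.continuousWithinAt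
  -- A conserved quantity: the weak equation says exactly that its derivative vanishes for `s > 0`,
  -- and continuity carries the conservation down to `s = 0`.
  let F : ℝ → ℂ := fun s =>
    pairing φ (v s) - pairing (Δ φ) (primitive u s + (ν : ℂ) • u s)
  have hF : ContinuousOn F (Set.Icc 0 t) := by
    have : ContinuousOn F (Set.Ici 0) :=
      ((pairing φ).continuous.comp_continuousOn hv).sub
        ((pairing (Δ φ)).continuous.comp_continuousOn (hU.add (hu.const_smul (ν : ℂ) :)))
    exact this.mono Set.Icc_subset_Ici_self
  have hd : ∀ s ∈ Set.Ioo 0 t, HasDerivAt F 0 s := by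
    intro s hs
    have h1 := heq φ s hs.1
    have h2 : HasDerivAt u (v s) s := (huv s hs.1.le).hasDerivAt (Ici_mem_nhds hs.1)
    have h3 := (hasDerivAt_primitive hu hs.1.le).add (h2.const_smul (ν : ℂ))
    have h4 := ((pairing (Δ φ)).restrictScalars ℝ).hasFDerivAt.comp_hasDerivAt s h3
    have h5 := h1.sub h4
    have h6 : (Δ (distr (u s))) φ + (ν : ℂ) * (Δ (distr (v s))) φ -
        (pairing (Δ φ)).restrictScalars ℝ (u s + (ν : ℂ) • v s) = 0 := by
      simp only [ContinuousLinearMap.coe_restrictScalars', map_add, map_smul, pairing_apply,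
        TemperedDistribution.laplacian_apply_apply, smul_eq_mul]
      ring
    rw [h6] at h5
    exact h5
  have key := intervalIntegral.integral_eq_sub_of_hasDerivAt_of_le ht hF hd (by simp)
  have hP0 : primitive u 0 = 0 := by simp [primitive]
  simp only [intervalIntegral.integral_zero, F, hu0, hv0, hP0] at key
  simp only [← pairing_apply]
  simp only [map_add, map_sub, map_smul, map_zero, smul_eq_mul] at key ⊢
  linear_combination -key

/-! ### Linear evolution in `L²` and the solution formula -/

/-- Multiplication of `L²` functions by an essentially bounded symbol. -/
def symbolMul (m : Space n → ℂ) (hm : MemLp m ⊤ volume) : L2 n →L[ℂ] L2 n :=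
  (ContinuousLinearMap.mul ℂ ℂ).holderL volume ⊤ 2 2 (hm.toLp m)

theorem coeFn_symbolMul (m : Space n → ℂ) (hm : MemLp m ⊤ volume) (f : L2 n) :
    symbolMul m hm f =ᵐ[volume] fun x => m x * f x := by
  have h := (ContinuousLinearMap.mul ℂ ℂ).coeFn_holder (r := 2) (hm.toLp m) f
  filter_upwards [h, hm.coeFn_toLp] with x hx hmx
  rw [← hmx]
  exact hx

/-- Multiplication by `exp(t m)` is differentiable in time in `L²`. -/
theorem hasDerivAt_exp_symbolMul {m : Space n → ℂ} (hm : MemLp m ⊤ volume) {K : ℝ}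
    (hK : ∀ x, ‖m x‖ ≤ K) (g : L2 n) {y : ℝ → L2 n}
    (hy : ∀ t, y t =ᵐ[volume] fun x => Complex.exp (t * m x) * g x) (t : ℝ) :
    HasDerivAt y (symbolMul m hm (y t)) t := by
  have hK0 : 0 ≤ K := (norm_nonneg (m 0)).trans (hK 0)
  rw [hasDerivAt_iff_isLittleO_nhds_zero]
  -- The remainder bound `|exp z - 1 - z| ≤ |z|²` for `|z| ≤ 1`, with `z = h m(x)`, is uniform in
  -- `x` because `m` is bounded.
  have hb : (fun h : ℝ => y (t + h) - y t - h • symbolMul m hm (y t)) =O[𝓝 0]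
      fun h : ℝ => h ^ 2 := by
    refine Asymptotics.IsBigO.of_bound (K ^ 2 * ‖y t‖) ?_
    have hsmall : ∀ᶠ h : ℝ in 𝓝 0, |h| * K < 1 := by
      have : ContinuousAt (fun h : ℝ => |h| * K) 0 := by fun_prop
      exact this.eventually_lt continuousAt_const (by simp)
    filter_upwards [hsmall] with h hh
    have : ‖y (t + h) - y t - h • symbolMul m hm (y t)‖ ≤ (K ^ 2 * h ^ 2) * ‖y t‖ := by
      refine Lp.norm_le_mul_norm_of_ae_le_mul ?_
      filter_upwards [hy (t + h), hy t, coeFn_symbolMul m hm (y t),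
        Lp.coeFn_sub (y (t + h) - y t) (h • symbolMul m hm (y t)),
        Lp.coeFn_sub (y (t + h)) (y t),
        Lp.coeFn_smul h (symbolMul m hm (y t))] with x h1 h2 h3 h4 h5 h6
      have hz : ‖(h : ℂ) * m x‖ ≤ |h| * K := by
        rw [norm_mul, Complex.norm_real, Real.norm_eq_abs]
        exact mul_le_mul_of_nonneg_left (hK x) (abs_nonneg h)
      have hexp := Complex.norm_exp_sub_one_sub_id_le (hz.trans hh.le)
      have heq : (y (t + h) - y t - h • symbolMul m hm (y t) : L2 n) x =
          (Complex.exp (h * m x) - 1 - h * m x) * y t x := by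
        rw [h4, Pi.sub_apply, h5, h6, Pi.sub_apply, Pi.smul_apply, h3, h1, h2]
        rw [show ((t + h : ℝ) : ℂ) * m x = t * m x + h * m x by push_cast; ring, Complex.exp_add,
          Complex.real_smul]
        ring
      rw [heq, norm_mul]
      refine mul_le_mul_of_nonneg_right (hexp.trans ?_) (norm_nonneg _)
      calc ‖(h : ℂ) * m x‖ ^ 2 ≤ (|h| * K) ^ 2 := by gcongr
        _ = K ^ 2 * h ^ 2 := by rw [mul_pow, sq_abs]; ring
    rw [Real.norm_of_nonneg (sq_nonneg h)]
    linarith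
  exact hb.trans_isLittleO (Asymptotics.isLittleO_pow_id one_lt_two)

theorem exists_exp_symbolMul {m : Space n → ℂ} (hm : MemLp m ⊤ volume) {K : ℝ}
    (hK : ∀ x, ‖m x‖ ≤ K) (g : L2 n) :
    ∃ y : ℝ → L2 n, ∀ t, y t =ᵐ[volume] fun x => Complex.exp (t * m x) * g x := by
  have he : ∀ t : ℝ, MemLp (fun x => Complex.exp (t * m x)) ⊤ (volume : Measure (Space n)) := by
    intro t
    refine memLp_top_of_bound (Complex.continuous_exp.comp_aestronglyMeasurable
      (hm.1.const_mul _)) (Real.exp (|t| * K)) (Eventually.of_forall fun x => ?_)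
    rw [Complex.norm_exp]
    refine Real.exp_le_exp.2 ((Complex.re_le_norm _).trans ?_)
    rw [norm_mul, Complex.norm_real, Real.norm_eq_abs]
    exact mul_le_mul_of_nonneg_left (hK x) (abs_nonneg t)
  exact ⟨fun t => symbolMul _ (he t) g, fun t => coeFn_symbolMul _ (he t) g⟩

/-- Solutions of `w' = m w` in `L²` on `[0, ∞)` are given by the exponential. -/
theorem ae_eq_exp_mul_of_hasDerivWithinAt {m : Space n → ℂ} (hm : MemLp m ⊤ volume) {K : ℝ}
    (hK : ∀ x, ‖m x‖ ≤ K) {w : ℝ → L2 n}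
    (hw : ∀ t : ℝ, 0 ≤ t → HasDerivWithinAt w (symbolMul m hm (w t)) (Set.Ici 0) t)
    {t : ℝ} (ht : 0 ≤ t) : w t =ᵐ[volume] fun x => Complex.exp (t * m x) * w 0 x := by
  obtain ⟨y, hy⟩ := exists_exp_symbolMul hm hK (w 0)
  have hy' := hasDerivAt_exp_symbolMul hm hK (w 0) hy
  have hy0 : w 0 = y 0 := by
    refine Lp.ext ?_
    filter_upwards [hy 0] with x hx
    simp [hx]
  have := ODE_solution_unique_of_mem_Icc_right (v := fun _ f => symbolMul m hm f)
    (K := ‖symbolMul m hm‖₊) (s := fun _ => Set.univ) (a := 0) (b := t) (f := w) (g := y)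
    (fun _ _ => (symbolMul m hm).lipschitz.lipschitzOnWith)
    (fun s hs => ((hw s hs.1).continuousWithinAt).mono Set.Icc_subset_Ici_self)
    (fun s hs => (hw s hs.1).mono (Set.Ici_subset_Ici.2 hs.1))
    (fun _ _ => Set.mem_univ _)
    (fun s _ => (hy' s).continuousAt.continuousWithinAt)
    (fun s _ => (hy' s).hasDerivWithinAt)
    (fun _ _ => Set.mem_univ _) hy0 (Set.right_mem_Icc.2 ht)
  rw [this]
  exact hy t

theorem memLp_top_indicator_closedBall {m : Space n → ℂ} (hm : Measurable m) {R K : ℝ}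
    (hK : ∀ x, ‖((Metric.closedBall (0 : Space n) R).indicator m) x‖ ≤ K) :
    MemLp ((Metric.closedBall (0 : Space n) R).indicator m) ⊤ volume :=
  memLp_top_of_bound
    ((hm.indicator Metric.isClosed_closedBall.measurableSet).aestronglyMeasurable) K
    (Eventually.of_forall hK)

theorem exists_bound_indicator_closedBall {m : Space n → ℂ}
    (hb : ∀ R : ℝ, ∃ K, ∀ x : Space n, ‖x‖ ≤ R → ‖m x‖ ≤ K) (R : ℝ) :
    ∃ K, ∀ x, ‖((Metric.closedBall (0 : Space n) R).indicator m) x‖ ≤ K := by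
  obtain ⟨K, hK⟩ := hb R
  refine ⟨max K 0, fun x => ?_⟩
  by_cases hx : x ∈ Metric.closedBall (0 : Space n) R
  · rw [Set.indicator_of_mem hx]
    exact (hK x (by simpa using hx)).trans (le_max_left _ _)
  · rw [Set.indicator_of_notMem hx]
    simp

/-- The Fourier transform of a solution satisfies, for each characteristic root `p` with
conjugate root `q`, the first order law `(∂ₜû - q û)(t) = exp(t p) (û₁ - q û₀)`. -/
theorem IsSolution.fourier_first_order {ν : ℝ} {u₀ u₁ : L2 n} {u v : ℝ → L2 n}
    (hv : ContinuousOn v (Set.Ici 0))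
    (huv : ∀ t : ℝ, 0 ≤ t → HasDerivWithinAt u (v t) (Set.Ici 0) t)
    (hu0 : u 0 = u₀) (hv0 : v 0 = u₁)
    (heq : ∀ φ : 𝓢(Space n, ℂ), ∀ t : ℝ, 0 < t →
      HasDerivAt (fun s : ℝ => distr (v s) φ)
        ((Δ (distr (u t))) φ + (ν : ℂ) * (Δ (distr (v t))) φ) t)
    {p q : Space n → ℂ} (hp : Measurable p) (hq : Measurable q)
    (hpb : ∀ R : ℝ, ∃ K, ∀ x : Space n, ‖x‖ ≤ R → ‖p x‖ ≤ K)
    (hqb : ∀ R : ℝ, ∃ K, ∀ x : Space n, ‖x‖ ≤ R → ‖q x‖ ≤ K)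
    (hsum : ∀ x, p x + q x = ((-ν * (2 * Real.pi * ‖x‖) ^ 2 : ℝ) : ℂ))
    (hprod : ∀ x, p x * q x = (((2 * Real.pi * ‖x‖) ^ 2 : ℝ) : ℂ))
    {t : ℝ} (ht : 0 ≤ t) :
    ∀ᵐ x : Space n, (𝓕 (v t) : L2 n) x - q x * (𝓕 (u t) : L2 n) x =
      Complex.exp (t * p x) * ((𝓕 u₁ : L2 n) x - q x * (𝓕 u₀ : L2 n) x) := by
  -- The roots may be unbounded in frequency; on a ball they act as bounded operators on `L²`, and
  -- countably many balls exhaust the space.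
  suffices H : ∀ N : ℕ, ∀ᵐ x : Space n, ‖x‖ ≤ N →
      (𝓕 (v t) : L2 n) x - q x * (𝓕 (u t) : L2 n) x =
      Complex.exp (t * p x) * ((𝓕 u₁ : L2 n) x - q x * (𝓕 u₀ : L2 n) x) by
    filter_upwards [ae_all_iff.2 H] with x hx
    obtain ⟨N, hN⟩ := exists_nat_ge ‖x‖
    exact hx N hN
  intro N
  have hone : ∀ R : ℝ, ∃ K, ∀ x : Space n, ‖x‖ ≤ R → ‖(1 : ℂ)‖ ≤ K :=
    fun _ => ⟨1, fun _ _ => by simp⟩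
  let ρ : Space n → ℂ := fun x => ((-(2 * Real.pi * ‖x‖) ^ 2 : ℝ) : ℂ)
  have hρm : Measurable ρ := by fun_prop
  have hρb : ∀ R : ℝ, ∃ K, ∀ x : Space n, ‖x‖ ≤ R → ‖ρ x‖ ≤ K := by
    refine fun R => ⟨(2 * Real.pi * R) ^ 2, fun x hx => ?_⟩
    simp only [ρ, Complex.norm_real, norm_neg]
    rw [Real.norm_of_nonneg (by positivity)]
    gcongr
  obtain ⟨_, hχ⟩ := exists_bound_indicator_closedBall hone N
  obtain ⟨K, hP⟩ := exists_bound_indicator_closedBall hpb N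
  obtain ⟨_, hQ⟩ := exists_bound_indicator_closedBall hqb N
  obtain ⟨_, hR⟩ := exists_bound_indicator_closedBall hρb N
  let hχL := memLp_top_indicator_closedBall measurable_const hχ
  let hPL := memLp_top_indicator_closedBall hp hP
  let hQL := memLp_top_indicator_closedBall hq hQ
  let hRL := memLp_top_indicator_closedBall hρm hR
  let X := symbolMul _ hχL
  let P := symbolMul _ hPL
  let Q := symbolMul _ hQL
  let S := symbolMul _ hRL
  let Φ : L2 n →L[ℂ] L2 n := FourierTransform.fourierCLM ℂ (L2 n)
  have hu : ContinuousOn u (Set.Ici 0) := fun s hs => (huv s hs).continuousWithinAt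
  -- This is `v̂ - q û` on the ball, with `v̂` replaced by its integrated expression: `v` is not
  -- known to be differentiable in `L²`, while this expression visibly is.
  let w : ℝ → L2 n := fun s =>
    X (Φ u₁) + S (Φ (primitive u s + (ν : ℂ) • (u s - u₀))) - Q (Φ (u s))
  have hwx : ∀ s : ℝ, 0 ≤ s → ∀ᵐ x : Space n, w s x =
      (Metric.closedBall (0 : Space n) N).indicator (fun x => (𝓕 (v s) : L2 n) x - q x * (𝓕 (u s) : L2 n) x) x := by
    intro s hs
    have hsub : (𝓕 (v s - u₁) : L2 n) = 𝓕 (v s) - 𝓕 u₁ := (Φ.map_sub _ _)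
    have := IsSolution.fourier_eq hv huv hu0 hv0 heq hs
    rw [hsub] at this
    filter_upwards [this, Lp.coeFn_sub (𝓕 (v s) : L2 n) (𝓕 u₁),
      Lp.coeFn_sub (X (Φ u₁) + S (Φ (primitive u s + (ν : ℂ) • (u s - u₀)))) (Q (Φ (u s))),
      Lp.coeFn_add (X (Φ u₁)) (S (Φ (primitive u s + (ν : ℂ) • (u s - u₀)))),
      coeFn_symbolMul _ hχL (Φ u₁),
      coeFn_symbolMul _ hRL (Φ (primitive u s + (ν : ℂ) • (u s - u₀))),
      coeFn_symbolMul _ hQL (Φ (u s))] with x h1 h2 h3 h4 h5 h6 h7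
    simp only [w]
    rw [h3, Pi.sub_apply, h4, Pi.add_apply, h5, h6, h7]
    rw [h2, Pi.sub_apply] at h1
    by_cases hx : x ∈ Metric.closedBall (0 : Space n) N
    · simp only [Set.indicator_of_mem hx]
      simp only [Φ, FourierTransform.fourierCLM_apply, ρ]
      linear_combination -h1
    · simp only [Set.indicator_of_notMem hx]
      ring
  have hwd : ∀ s : ℝ, 0 ≤ s → HasDerivWithinAt w (P (w s)) (Set.Ici 0) s := by
    intro s hs
    have h1 := (hasDerivAt_primitive hu hs).hasDerivWithinAt (s := Set.Ici 0)
    have h2 := huv s hs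
    have h3 := h1.add ((h2.sub_const u₀).const_smul (ν : ℂ))
    have h4 := ((S ∘L Φ).restrictScalars ℝ).hasFDerivAt.comp_hasDerivWithinAt s h3
    have h5 := ((Q ∘L Φ).restrictScalars ℝ).hasFDerivAt.comp_hasDerivWithinAt s h2
    have h6 := (h4.const_add (X (Φ u₁))).sub h5
    -- Vieta's relations factor the second order operator: `p (v̂ - q û) = -r² (û + ν v̂) - q v̂`.
    have h7 : P (w s) = ((S ∘L Φ).restrictScalars ℝ) (u s + (ν : ℂ) • v s) -
        ((Q ∘L Φ).restrictScalars ℝ) (v s) := by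
      simp only [ContinuousLinearMap.coe_restrictScalars', ContinuousLinearMap.comp_apply]
      rw [map_add Φ, map_smul Φ]
      refine Lp.ext ?_
      filter_upwards [hwx s hs, coeFn_symbolMul _ hPL (w s),
        Lp.coeFn_sub (S (Φ (u s) + (ν : ℂ) • Φ (v s))) (Q (Φ (v s))),
        coeFn_symbolMul _ hRL (Φ (u s) + (ν : ℂ) • Φ (v s)),
        coeFn_symbolMul _ hQL (Φ (v s)),
        Lp.coeFn_add (Φ (u s)) ((ν : ℂ) • Φ (v s)),
        Lp.coeFn_smul (ν : ℂ) (Φ (v s))] with x h1 h2 h3 h4 h5 h6 h7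
      rw [h2, h1, h3, Pi.sub_apply, h4, h5, h6, Pi.add_apply, h7, Pi.smul_apply, smul_eq_mul]
      by_cases hx : x ∈ Metric.closedBall (0 : Space n) N
      · simp only [Set.indicator_of_mem hx, ρ, Φ, FourierTransform.fourierCLM_apply]
        have e1 := hsum x
        have e2 := hprod x
        push_cast at e1 e2 ⊢
        linear_combination (-(𝓕 (u s) : L2 n) x) * e2 + ((𝓕 (v s) : L2 n) x) * e1
      · simp only [Set.indicator_of_notMem hx]
        ring
    rw [h7]
    exact h6
  have hfin := ae_eq_exp_mul_of_hasDerivWithinAt hPL hP hwd ht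
  have hw0 := hwx 0 le_rfl
  rw [hu0, hv0] at hw0
  filter_upwards [hfin, hwx t ht, hw0] with x h1 h2 h3 hxN
  have hx : x ∈ Metric.closedBall (0 : Space n) N := by simpa using hxN
  rw [h2, h3] at h1
  simpa only [Set.indicator_of_mem hx] using h1

/-- The first order law holds with the roles of the two roots exchanged, and subtracting eliminates
`v̂`. Leaving the factor `p - q` undivided avoids any case distinction at a double root. -/
theorem IsSolution.fourier_roots {ν : ℝ} {u₀ u₁ : L2 n} {u : ℝ → L2 n}
    (hu : IsSolution ν u₀ u₁ u) {p q : Space n → ℂ} (hp : Measurable p) (hq : Measurable q)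
    (hpb : ∀ R : ℝ, ∃ K, ∀ x : Space n, ‖x‖ ≤ R → ‖p x‖ ≤ K)
    (hqb : ∀ R : ℝ, ∃ K, ∀ x : Space n, ‖x‖ ≤ R → ‖q x‖ ≤ K)
    (hsum : ∀ x, p x + q x = ((-ν * (2 * Real.pi * ‖x‖) ^ 2 : ℝ) : ℂ))
    (hprod : ∀ x, p x * q x = (((2 * Real.pi * ‖x‖) ^ 2 : ℝ) : ℂ))
    {t : ℝ} (ht : 0 ≤ t) :
    ∀ᵐ x : Space n, (p x - q x) * (𝓕 (u t) : L2 n) x =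
      (Complex.exp (t * p x) - Complex.exp (t * q x)) * (𝓕 u₁ : L2 n) x +
      (p x * Complex.exp (t * q x) - q x * Complex.exp (t * p x)) * (𝓕 u₀ : L2 n) x := by
  obtain ⟨-, v, hv, huv, hu0, hv0, heq⟩ := hu
  filter_upwards [IsSolution.fourier_first_order hv huv hu0 hv0 heq hp hq hpb hqb hsum hprod ht,
    IsSolution.fourier_first_order hv huv hu0 hv0 heq hq hp hqb hpb
      (fun x => (add_comm _ _).trans (hsum x)) (fun x => (mul_comm _ _).trans (hprod x)) ht]
    with x h1 h2
  linear_combination h1 - h2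

/-! ### Propagators of the damped oscillator -/

theorem mul_exp_neg_le_one (x : ℝ) : x * Real.exp (-x) ≤ 1 := by
  have h := Real.add_one_le_exp x
  rw [Real.exp_neg, ← div_eq_mul_inv, div_le_one (Real.exp_pos x)]
  linarith

/-- The low frequency part of the difference between the free and the damped wave symbols, at
angular frequency `r`. -/
def lowKernel (ν t r : ℝ) : ℝ :=
  if ν * r ≤ 1 then (1 - Real.exp (-(ν * r ^ 2 / 2 * t))) * Real.sin (t * r) / r else 0

/-- The square root of the discriminant of `z² + ν r² z + r² = 0`, halved. -/
def rootDisc (ν r : ℝ) : ℂ :=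
  (Real.sqrt ((ν * r ^ 2 / 2) ^ 2 - r ^ 2) : ℂ) +
    (Real.sqrt (r ^ 2 - (ν * r ^ 2 / 2) ^ 2) : ℂ) * Complex.I

/-- `Real.sqrt` is zero on negative numbers, so only one of the two terms survives on each side of
the threshold `ν r = 2`. -/
theorem rootDisc_sq (ν r : ℝ) :
    rootDisc ν r ^ 2 = (((ν * r ^ 2 / 2) ^ 2 - r ^ 2 : ℝ) : ℂ) := by
  unfold rootDisc
  rcases le_total ((ν * r ^ 2 / 2) ^ 2) (r ^ 2) with h | h
  · rw [Real.sqrt_eq_zero_of_nonpos (x := (ν * r ^ 2 / 2) ^ 2 - r ^ 2) (by linarith),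
      Complex.ofReal_zero, zero_add, mul_pow,
      Complex.I_sq, ← Complex.ofReal_pow, Real.sq_sqrt (by linarith)]
    push_cast
    ring
  · rw [Real.sqrt_eq_zero_of_nonpos (x := r ^ 2 - (ν * r ^ 2 / 2) ^ 2) (by linarith),
      Complex.ofReal_zero, zero_mul, add_zero,
      ← Complex.ofReal_pow, Real.sq_sqrt (by linarith)]

theorem rootDisc_of_lt {ν r : ℝ} (hν : 0 < ν) (hr : 0 < r) (h : ν * r < 2) :
    ∃ b : ℝ, 0 < b ∧ b ^ 2 = r ^ 2 - (ν * r ^ 2 / 2) ^ 2 ∧ rootDisc ν r = b * Complex.I := by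
  have h1 : ν * r ^ 2 / 2 < r := by nlinarith
  have h2 : (ν * r ^ 2 / 2) ^ 2 < r ^ 2 := pow_lt_pow_left₀ h1 (by positivity) two_ne_zero
  refine ⟨Real.sqrt (r ^ 2 - (ν * r ^ 2 / 2) ^ 2), Real.sqrt_pos.2 (by linarith),
    Real.sq_sqrt (by linarith), ?_⟩
  rw [rootDisc, Real.sqrt_eq_zero_of_nonpos (x := (ν * r ^ 2 / 2) ^ 2 - r ^ 2) (by linarith)]
  simp

theorem rootDisc_of_gt {ν r : ℝ} (hr : 0 < r) (h : 2 < ν * r) :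
    ∃ d : ℝ, 0 < d ∧ d ^ 2 = (ν * r ^ 2 / 2) ^ 2 - r ^ 2 ∧ rootDisc ν r = d := by
  have h1 : r < ν * r ^ 2 / 2 := by nlinarith
  have h2 : r ^ 2 < (ν * r ^ 2 / 2) ^ 2 := pow_lt_pow_left₀ h1 hr.le two_ne_zero
  refine ⟨Real.sqrt ((ν * r ^ 2 / 2) ^ 2 - r ^ 2), Real.sqrt_pos.2 (by linarith),
    Real.sq_sqrt (by linarith), ?_⟩
  rw [rootDisc, Real.sqrt_eq_zero_of_nonpos (x := r ^ 2 - (ν * r ^ 2 / 2) ^ 2) (by linarith)]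
  simp

theorem abs_sin_mul_div_le {b t : ℝ} (hb : 0 < b) (ht : 0 ≤ t) : |Real.sin (b * t) / b| ≤ t := by
  rw [abs_div, abs_of_pos hb, div_le_iff₀ hb]
  calc |Real.sin (b * t)| ≤ |b * t| := Real.abs_sin_le_abs
    _ = t * b := by rw [abs_of_nonneg (by positivity)]; ring

/-- With `a = ν r² / 2`, the frequency shift `r - b` is at most `ν a r / 2`. The phase error after
time `t`, divided by `b`, is therefore at most `ν a t`, and `exp(-a t)` absorbs the growth in `t`.
-/
theorem abs_sin_div_sub_sin_div_le {ν r b t : ℝ} (hν : 0 < ν) (hr : 0 < r) (hb : 0 < b)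
    (ht : 0 ≤ t) (hb2 : b ^ 2 = r ^ 2 - (ν * r ^ 2 / 2) ^ 2) (hνr : ν * r ≤ 1) :
    Real.exp (-(ν * r ^ 2 / 2 * t)) * |Real.sin (b * t) / b - Real.sin (t * r) / r| ≤ 2 * ν := by
  set a := ν * r ^ 2 / 2 with ha
  have ha0 : 0 < a := by positivity
  have hbr : b ≤ r := by nlinarith
  -- The cutoff `ν r ≤ 1` gives `a ≤ r / 2`, hence `b² ≥ 3 r² / 4`.
  have hrb : r ≤ 2 * b := by
    have h1 : a ≤ r / 2 := by rw [ha]; nlinarith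
    nlinarith
  -- Since `(r - b)(r + b) = a²` and `b > 0`.
  have hdiff : (r - b) * r ≤ a ^ 2 := by nlinarith
  have hdiff2 : r - b ≤ ν * a * (r / 2) := by
    have : ν * a * (r / 2) * r = a ^ 2 := by rw [ha]; ring
    exact le_of_mul_le_mul_right (by linarith) hr
  have hsplit : Real.sin (b * t) / b - Real.sin (t * r) / r =
      (Real.sin (b * t) - Real.sin (t * r)) / b + Real.sin (t * r) * ((r - b) / (r * b)) := by
    field_simp
    ring
  have h1 : |(Real.sin (b * t) - Real.sin (t * r)) / b| ≤ ν * (a * t) := by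
    rw [abs_div, abs_of_pos hb, div_le_iff₀ hb]
    calc |Real.sin (b * t) - Real.sin (t * r)| ≤ |b * t - t * r| := by
          have := Real.lipschitzWith_sin.dist_le_mul (b * t) (t * r)
          simpa [Real.dist_eq] using this
      _ = t * (r - b) := by rw [abs_sub_comm, abs_of_nonneg (by nlinarith)]; ring
      _ ≤ t * (ν * a * (r / 2)) := by gcongr
      _ ≤ t * (ν * a * b) := by gcongr; linarith
      _ = ν * (a * t) * b := by ring
  have h2 : |Real.sin (t * r) * ((r - b) / (r * b))| ≤ ν := by
    rw [abs_mul]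
    have h3 : |(r - b) / (r * b)| ≤ ν := by
      rw [abs_of_nonneg (div_nonneg (by linarith) (by positivity)), div_le_iff₀ (by positivity)]
      have h4 : ν * a * (r / 2) ≤ ν * a * b := by gcongr; linarith
      have h5 : a ≤ r := by rw [ha]; nlinarith
      have h6 : ν * a * b ≤ ν * r * b := by gcongr
      linarith
    calc |Real.sin (t * r)| * |(r - b) / (r * b)| ≤ 1 * ν := by
          gcongr
          exact Real.abs_sin_le_one _
      _ = ν := one_mul _
  have h3 : |Real.sin (b * t) / b - Real.sin (t * r) / r| ≤ ν * (a * t) + ν := by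
    rw [hsplit]
    exact (abs_add_le _ _).trans (add_le_add h1 h2)
  have h4 : Real.exp (-(a * t)) ≤ 1 := Real.exp_le_one_iff.2 (by nlinarith)
  have h5 := mul_exp_neg_le_one (a * t)
  calc Real.exp (-(a * t)) * |Real.sin (b * t) / b - Real.sin (t * r) / r|
      ≤ Real.exp (-(a * t)) * (ν * (a * t) + ν) := by gcongr
    _ = ν * (a * t * Real.exp (-(a * t))) + ν * Real.exp (-(a * t)) := by ring
    _ ≤ ν * 1 + ν * 1 := by gcongr
    _ = 2 * ν := by ring

theorem sinh_le_mul_exp {y : ℝ} : Real.sinh y ≤ y * Real.exp y := by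
  have h := Real.add_one_le_exp (-2 * y)
  have h2 : Real.exp (-y) = Real.exp y * Real.exp (-2 * y) := by
    rw [← Real.exp_add]; ring_nf
  rw [Real.sinh_eq, h2]
  nlinarith [Real.exp_pos y]

theorem abs_sin_div_le_of_one_lt {ν r t : ℝ} (hr : 0 < r) (h : 1 < ν * r) :
    |Real.sin (t * r) / r| ≤ ν := by
  rw [abs_div, abs_of_pos hr, div_le_iff₀ hr]
  exact (Real.abs_sin_le_one _).trans h.le

/-- The propagators of the damped oscillator in the oscillatory range `ν r < 2`. -/
theorem exists_propagators_of_lt {ν r t : ℝ} (hν : 0 < ν) (hr : 0 < r) (h : ν * r < 2)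
    (ht : 0 ≤ t) : ∃ E₀ E₁ : ℝ, |E₀| ≤ 3 ∧
      |E₁ - Real.sin (t * r) / r + lowKernel ν t r| ≤ 3 * ν ∧ rootDisc ν r ≠ 0 ∧
      ∀ p q : ℂ, p = -((ν * r ^ 2 / 2 : ℝ) : ℂ) + rootDisc ν r →
        q = -((ν * r ^ 2 / 2 : ℝ) : ℂ) - rootDisc ν r →
        Complex.exp (t * p) - Complex.exp (t * q) = (p - q) * E₁ ∧
        p * Complex.exp (t * q) - q * Complex.exp (t * p) = (p - q) * E₀ := by
  obtain ⟨b, hb, hb2, hroot⟩ := rootDisc_of_lt hν hr h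
  have hsd := fun h' => abs_sin_div_sub_sin_div_le hν hr hb ht hb2 h'
  have hlow : lowKernel ν t r = if ν * r ≤ 1 then
    (1 - Real.exp (-(ν * r ^ 2 / 2 * t))) * Real.sin (t * r) / r else 0 := rfl
  -- Above the cutoff the damping rate satisfies `a ≥ 1 / (2ν)`, so `E₁` needs no comparison with
  -- the free wave.
  have hlower : 1 < ν * r → 1 / (ν * r ^ 2 / 2) ≤ 2 * ν := by
    intro h1
    rw [div_le_iff₀ (by positivity)]
    nlinarith
  set a := ν * r ^ 2 / 2 with ha
  have ha0 : 0 < a := by positivity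
  have hsin := abs_sin_mul_div_le hb ht
  have hexp1 : Real.exp (-(a * t)) ≤ 1 := Real.exp_le_one_iff.2 (by nlinarith)
  have haE : a * |Real.exp (-(a * t)) * (Real.sin (b * t) / b)| ≤ 1 := by
    rw [abs_mul, abs_of_pos (Real.exp_pos _)]
    calc a * (Real.exp (-(a * t)) * |Real.sin (b * t) / b|)
        ≤ a * (Real.exp (-(a * t)) * t) := by gcongr
      _ = a * t * Real.exp (-(a * t)) := by ring
      _ ≤ 1 := mul_exp_neg_le_one _
  -- The oscillator solutions with data `(1, 0)` and `(0, 1)`.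
  refine ⟨Real.exp (-(a * t)) * (Real.cos (b * t) + a * (Real.sin (b * t) / b)),
    Real.exp (-(a * t)) * (Real.sin (b * t) / b), ?_, ?_, ?_, ?_⟩
  · have h1 : |Real.exp (-(a * t)) * Real.cos (b * t)| ≤ 1 := by
      rw [abs_mul, abs_of_pos (Real.exp_pos _)]
      exact mul_le_one₀ hexp1 (abs_nonneg _) (Real.abs_cos_le_one _)
    have h2 : |a * (Real.exp (-(a * t)) * (Real.sin (b * t) / b))| ≤ 1 := by
      rwa [abs_mul, abs_of_pos ha0]
    have h3 := abs_add_le (Real.exp (-(a * t)) * Real.cos (b * t))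
      (a * (Real.exp (-(a * t)) * (Real.sin (b * t) / b)))
    rw [show Real.exp (-(a * t)) * (Real.cos (b * t) + a * (Real.sin (b * t) / b)) =
      Real.exp (-(a * t)) * Real.cos (b * t) +
      a * (Real.exp (-(a * t)) * (Real.sin (b * t) / b)) by ring]
    linarith
  · rw [hlow]
    split_ifs with h1
    · rw [show Real.exp (-(a * t)) * (Real.sin (b * t) / b) - Real.sin (t * r) / r +
          (1 - Real.exp (-(a * t))) * Real.sin (t * r) / r =
          Real.exp (-(a * t)) * (Real.sin (b * t) / b - Real.sin (t * r) / r) by ring, abs_mul,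
        abs_of_pos (Real.exp_pos _)]
      linarith [hsd h1]
    · rw [not_le] at h1
      have h2 := abs_sin_div_le_of_one_lt (t := t) hr h1
      have h3 := abs_sub (Real.exp (-(a * t)) * (Real.sin (b * t) / b)) (Real.sin (t * r) / r)
      have h4 : |Real.exp (-(a * t)) * (Real.sin (b * t) / b)| ≤ 2 * ν := by
        refine le_trans ?_ (hlower h1)
        rw [le_div_iff₀ ha0]
        linarith
      rw [add_zero]
      linarith
  · rw [hroot]
    simp [hb.ne']
  · have hbc : (b : ℂ) ≠ 0 := by exact_mod_cast hb.ne'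
    rintro p q rfl rfl
    have e1 : Complex.exp (t * (-(a : ℂ) + rootDisc ν r)) =
        Complex.exp (-(a * t)) * (Complex.cos (b * t) + Complex.sin (b * t) * Complex.I) := by
      rw [← Complex.exp_mul_I, ← Complex.exp_add, hroot]
      ring_nf
    have e2 : Complex.exp (t * (-(a : ℂ) - rootDisc ν r)) =
        Complex.exp (-(a * t)) * (Complex.cos (b * t) - Complex.sin (b * t) * Complex.I) := by
      have e3 : Complex.cos (b * t) - Complex.sin (b * t) * Complex.I =
          Complex.exp (-(b * t) * Complex.I) := by
        rw [Complex.exp_mul_I, Complex.cos_neg, Complex.sin_neg]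
        ring
      rw [e3, ← Complex.exp_add, hroot]
      ring_nf
    rw [e1, e2, hroot]
    push_cast
    constructor
    · field_simp
      ring
    · field_simp
      ring_nf

/-- In the overdamped range the slow decay rate is `a - d = r² / (a + d) ≥ r² / (2a) = 1 / ν`,
bounded below uniformly in `r`. This bounds `E₁` by `ν`, and `sin(t r) / r` is itself at most `ν`
there. -/
theorem exists_propagators_of_gt {ν r t : ℝ} (hν : 0 < ν) (hr : 0 < r) (h : 2 < ν * r)
    (ht : 0 ≤ t) : ∃ E₀ E₁ : ℝ, |E₀| ≤ 3 ∧
      |E₁ - Real.sin (t * r) / r + lowKernel ν t r| ≤ 3 * ν ∧ rootDisc ν r ≠ 0 ∧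
      ∀ p q : ℂ, p = -((ν * r ^ 2 / 2 : ℝ) : ℂ) + rootDisc ν r →
        q = -((ν * r ^ 2 / 2 : ℝ) : ℂ) - rootDisc ν r →
        Complex.exp (t * p) - Complex.exp (t * q) = (p - q) * E₁ ∧
        p * Complex.exp (t * q) - q * Complex.exp (t * p) = (p - q) * E₀ := by
  obtain ⟨d, hd, hd2, hroot⟩ := rootDisc_of_gt hr h
  have hlow : lowKernel ν t r = 0 := if_neg (by linarith)
  have h2a : r ^ 2 * ν = 2 * (ν * r ^ 2 / 2) := by ring
  set a := ν * r ^ 2 / 2 with ha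
  have ha0 : 0 < a := by positivity
  have hda : d < a := by
    have : d ^ 2 < a ^ 2 := by nlinarith
    exact lt_of_pow_lt_pow_left₀ 2 ha0.le this
  have hdt : 0 ≤ d * t := by positivity
  have hexp : Real.exp (-(a * t)) * Real.exp (d * t) = Real.exp (-((a - d) * t)) := by
    rw [← Real.exp_add]
    ring_nf
  have hexp1 : Real.exp (-((a - d) * t)) ≤ 1 :=
    Real.exp_le_one_iff.2 (by nlinarith)
  set E := Real.exp (-(a * t)) * (Real.sinh (d * t) / d) with hE
  have hE0 : 0 ≤ E :=
    mul_nonneg (Real.exp_pos _).le (div_nonneg (Real.sinh_nonneg_iff.2 hdt) hd.le)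
  have hEle : E ≤ t * Real.exp (-((a - d) * t)) := by
    have h1 : Real.sinh (d * t) / d ≤ t * Real.exp (d * t) := by
      rw [div_le_iff₀ hd]
      linarith [sinh_le_mul_exp (y := d * t)]
    calc E ≤ Real.exp (-(a * t)) * (t * Real.exp (d * t)) := by rw [hE]; gcongr
      _ = t * Real.exp (-((a - d) * t)) := by rw [← hexp]; ring
  have hEle2 : (a - d) * E ≤ 1 := by
    calc (a - d) * E ≤ (a - d) * (t * Real.exp (-((a - d) * t))) := by
          gcongr
      _ = (a - d) * t * Real.exp (-((a - d) * t)) := by ring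
      _ ≤ 1 := mul_exp_neg_le_one _
  have hEν : E ≤ ν := by
    have h1 : 1 ≤ ν * (a - d) := by
      have h3 : r ^ 2 ≤ (a - d) * (2 * a) := by nlinarith
      have h4 : 0 < r ^ 2 := by positivity
      have h5 : r ^ 2 * 1 ≤ r ^ 2 * (ν * (a - d)) := by nlinarith
      exact le_of_mul_le_mul_left h5 h4
    have h2 : 0 < a - d := by linarith
    nlinarith
  -- Either `d` or `a - d` is at least `a / 2`, and `d E` and `(a - d) E` are both at most 1.
  have haE : a * E ≤ 2 := by
    rcases le_total (a / 2) d with h1 | h1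
    · have h3 : Real.sinh (d * t) ≤ Real.exp (d * t) := by
        rw [Real.sinh_eq]
        linarith [Real.exp_pos (d * t), Real.exp_pos (-(d * t))]
      have h4 : d * E ≤ 1 := by
        calc d * E = Real.exp (-(a * t)) * Real.sinh (d * t) := by
              rw [hE]; field_simp
          _ ≤ Real.exp (-(a * t)) * Real.exp (d * t) := by gcongr
          _ ≤ 1 := by rw [hexp]; exact hexp1
      nlinarith
    · nlinarith
  refine ⟨Real.exp (-(a * t)) * Real.cosh (d * t) + a * E, E, ?_, ?_, ?_, ?_⟩
  · have h1 : Real.cosh (d * t) ≤ Real.exp (d * t) := by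
      rw [Real.cosh_eq]
      have : Real.exp (-(d * t)) ≤ Real.exp (d * t) := Real.exp_le_exp.2 (by linarith)
      linarith
    have h2 : Real.exp (-(a * t)) * Real.cosh (d * t) ≤ 1 :=
      (mul_le_mul_of_nonneg_left h1 (Real.exp_pos _).le).trans (hexp.le.trans hexp1)
    have h3 : 0 ≤ Real.exp (-(a * t)) * Real.cosh (d * t) := by positivity
    rw [abs_of_nonneg (by positivity)]
    linarith
  · have h1 := abs_sin_div_le_of_one_lt (t := t) hr (by linarith : 1 < ν * r)
    have h3 := abs_sub E (Real.sin (t * r) / r)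
    rw [abs_of_nonneg hE0] at h3
    rw [hlow, add_zero]
    linarith
  · rw [hroot]
    exact_mod_cast hd.ne'
  · have hdc : (d : ℂ) ≠ 0 := by exact_mod_cast hd.ne'
    rintro p q rfl rfl
    have e1 : Complex.exp (t * (-(a : ℂ) + rootDisc ν r)) =
        Complex.exp (-(a * t)) * (Complex.cosh (d * t) + Complex.sinh (d * t)) := by
      rw [Complex.cosh_add_sinh, ← Complex.exp_add, hroot]
      ring_nf
    have e2 : Complex.exp (t * (-(a : ℂ) - rootDisc ν r)) =
        Complex.exp (-(a * t)) * (Complex.cosh (d * t) - Complex.sinh (d * t)) := by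
      rw [Complex.cosh_sub_sinh, ← Complex.exp_add, hroot]
      ring_nf
    rw [e1, e2, hroot, hE]
    push_cast
    constructor
    · field_simp
      ring
    · field_simp
      ring

/-! ### Reduction to the low frequency kernel -/

theorem measurable_lowKernel (ν t : ℝ) : Measurable (lowKernel ν t) := by
  unfold lowKernel
  exact Measurable.ite (measurableSet_le (by fun_prop) (by fun_prop)) (by fun_prop) (by fun_prop)

theorem one_sub_exp_neg_mem {s : ℝ} (hs : 0 ≤ s) :
    0 ≤ 1 - Real.exp (-s) ∧ 1 - Real.exp (-s) ≤ 1 := by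
  have h1 : Real.exp (-s) ≤ 1 := Real.exp_le_one_iff.2 (by linarith)
  have h2 := Real.exp_pos (-s)
  constructor <;> linarith

theorem abs_lowKernel_le {ν t r : ℝ} (hν : 0 < ν) (ht : 0 ≤ t) (hr : 0 ≤ r) :
    |lowKernel ν t r| ≤ t := by
  unfold lowKernel
  split_ifs
  · rcases hr.eq_or_lt with rfl | hr
    · simpa using ht
    · have h := one_sub_exp_neg_mem (s := ν * r ^ 2 / 2 * t) (by positivity)
      rw [mul_div_assoc, abs_mul, abs_of_nonneg h.1]
      have h2 := abs_sin_mul_div_le hr ht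
      rw [mul_comm r t] at h2
      calc _ ≤ 1 * |Real.sin (t * r) / r| := by gcongr; exact h.2
        _ ≤ t := by linarith
  · simpa using ht

theorem memLp_lowKernel_mul {ν t : ℝ} (hν : 0 < ν) (ht : 0 ≤ t) (f : L2 n) :
    MemLp (fun x : Space n => (lowKernel ν t (2 * Real.pi * ‖x‖) : ℂ) * f x) 2 volume := by
  have hm : Measurable fun x : Space n => lowKernel ν t (2 * Real.pi * ‖x‖) :=
    (measurable_lowKernel ν t).comp (by fun_prop)
  refine MemLp.of_le_mul (c := t) (Lp.memLp f) ?_ ?_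
  · exact (Complex.measurable_ofReal.comp hm).aestronglyMeasurable.mul (Lp.memLp f).1
  · refine Eventually.of_forall fun x => ?_
    rw [norm_mul, Complex.norm_real, Real.norm_eq_abs]
    exact mul_le_mul_of_nonneg_right (abs_lowKernel_le hν ht (by positivity)) (norm_nonneg _)

theorem Lp_norm_le_add_of_ae_le {f g h : L2 n} {a b : ℝ} (ha : 0 ≤ a) (hb : 0 ≤ b)
    (H : ∀ᵐ x : Space n, ‖f x‖ ≤ a * ‖g x‖ + b * ‖h x‖) : ‖f‖ ≤ a * ‖g‖ + b * ‖h‖ := by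
  let N : L2 n → Lp ℝ 2 (volume : Measure (Space n)) := fun k => (Lp.memLp k).norm.toLp _
  have hN : ∀ k, ‖N k‖ = ‖k‖ := fun k => by
    rw [Lp.norm_toLp, Lp.norm_def, eLpNorm_norm]
  have h1 : ‖f‖ ≤ ‖a • N g + b • N h‖ := by
    refine Lp.norm_le_norm_of_ae_le ?_
    filter_upwards [H, Lp.coeFn_add (a • N g) (b • N h), Lp.coeFn_smul a (N g),
      Lp.coeFn_smul b (N h), (Lp.memLp g).norm.coeFn_toLp, (Lp.memLp h).norm.coeFn_toLp]
      with x h1 h2 h3 h4 h5 h6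
    rw [h2, Pi.add_apply, h3, h4, Pi.smul_apply, Pi.smul_apply, h5, h6, smul_eq_mul, smul_eq_mul]
    exact h1.trans (le_abs_self _)
  calc ‖f‖ ≤ ‖a • N g + b • N h‖ := h1
    _ ≤ ‖a • N g‖ + ‖b • N h‖ := norm_add_le _ _
    _ = a * ‖g‖ + b * ‖h‖ := by
      rw [norm_smul, norm_smul, hN, hN, Real.norm_of_nonneg ha, Real.norm_of_nonneg hb]

theorem continuous_rootDisc_norm (ν : ℝ) :
    Continuous fun x : Space n => rootDisc ν (2 * Real.pi * ‖x‖) := by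
  unfold rootDisc
  fun_prop

theorem exists_bound_of_continuous {m : Space n → ℂ} (hm : Continuous m) (R : ℝ) :
    ∃ K, ∀ x : Space n, ‖x‖ ≤ R → ‖m x‖ ≤ K := by
  obtain ⟨K, hK⟩ := (isCompact_closedBall (0 : Space n) R).exists_bound_of_continuousOn
    hm.continuousOn
  exact ⟨K, fun x hx => hK x (by simpa using hx)⟩

theorem ae_norm_ne [Nontrivial (Space n)] (c : ℝ) : ∀ᵐ x : Space n, ‖x‖ ≠ c := by
  have := Measure.addHaar_sphere (volume : Measure (Space n)) 0 c
  rw [ae_iff]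
  convert this using 2
  ext x
  simp

/-- Up to errors bounded by the `L²` norms of the data, the distance to the free wave is the norm
of the low frequency kernel applied to `û₁`. -/
theorem IsSolution.abs_norm_sub_freeWave_sub_le [Nontrivial (Space n)] {ν : ℝ} (hν : 0 < ν)
    {u₀ u₁ : L2 n} {u : ℝ → L2 n} (hu : IsSolution ν u₀ u₁ u) {t : ℝ} (ht : 0 ≤ t) :
    |‖u t - freeWave t u₁‖ - ‖(memLp_lowKernel_mul hν ht (𝓕 u₁ : L2 n)).toLp‖| ≤
      3 * ‖u₀‖ + 3 * ν * ‖u₁‖ := by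
  set G := (memLp_lowKernel_mul hν ht (𝓕 u₁ : L2 n)).toLp with hG
  let Φ : L2 n →L[ℂ] L2 n := FourierTransform.fourierCLM ℂ (L2 n)
  have hWF : (𝓕 (u t - freeWave t u₁) : L2 n) = 𝓕 (u t) - (memLp_waveSymbol_mul t (𝓕 u₁)).toLp
      (fun x : Space n => (waveSymbol t x : ℂ) * (𝓕 u₁ : L2 n) x) := by
    refine (Φ.map_sub _ _).trans ?_
    simp only [Φ, FourierTransform.fourierCLM_apply, freeWave]
    rw [FourierTransform.fourier_fourierInv_eq]
  -- The kernel is free minus damped, so the difference on the left is compared with `-G`.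
  rw [← Lp.norm_fourier_eq (u t - freeWave t u₁), ← norm_neg G]
  refine (abs_norm_sub_norm_le _ _).trans ?_
  rw [sub_neg_eq_add, ← Lp.norm_fourier_eq u₀, ← Lp.norm_fourier_eq u₁]
  refine Lp_norm_le_add_of_ae_le (by norm_num) (by positivity) ?_
  rw [hWF]
  have hσ := continuous_rootDisc_norm (n := n) ν
  have ha : Continuous fun x : Space n => ((ν * (2 * Real.pi * ‖x‖) ^ 2 / 2 : ℝ) : ℂ) := by
    fun_prop
  have hpc := ha.neg.add hσ
  have hqc := ha.neg.sub hσ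
  have key := hu.fourier_roots hpc.measurable hqc.measurable (exists_bound_of_continuous hpc)
    (exists_bound_of_continuous hqc) (fun x => by
      simp only [Pi.neg_apply, Pi.add_apply, Pi.sub_apply]
      push_cast
      ring)
    (fun x => by
      have h := rootDisc_sq ν (2 * Real.pi * ‖x‖)
      simp only [Pi.neg_apply, Pi.add_apply, Pi.sub_apply]
      push_cast at h ⊢
      linear_combination -h) ht
  -- The two excluded spheres are `r = 0` and the double root `ν r = 2`.
  filter_upwards [key, ae_norm_ne 0, ae_norm_ne (2 / (2 * Real.pi * ν)),
    Lp.coeFn_add (𝓕 (u t) - (memLp_waveSymbol_mul t (𝓕 u₁)).toLp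
      (fun x : Space n => (waveSymbol t x : ℂ) * (𝓕 u₁ : L2 n) x)) G,
    Lp.coeFn_sub (𝓕 (u t) : L2 n) ((memLp_waveSymbol_mul t (𝓕 u₁)).toLp
      (fun x : Space n => (waveSymbol t x : ℂ) * (𝓕 u₁ : L2 n) x)),
    (memLp_waveSymbol_mul t (𝓕 u₁)).coeFn_toLp,
    (memLp_lowKernel_mul hν ht (𝓕 u₁ : L2 n)).coeFn_toLp] with x hx h0 h2 e1 e2 e3 e4
  have hr : 0 < 2 * Real.pi * ‖x‖ := by
    have : 0 < ‖x‖ := lt_of_le_of_ne (norm_nonneg x) h0.symm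
    positivity
  have hne : ν * (2 * Real.pi * ‖x‖) ≠ 2 := by
    intro h
    apply h2
    have := Real.pi_pos
    field_simp
    linarith
  have hE : ∃ E₀ E₁ : ℝ, |E₀| ≤ 3 ∧
      |E₁ - Real.sin (t * (2 * Real.pi * ‖x‖)) / (2 * Real.pi * ‖x‖) +
        lowKernel ν t (2 * Real.pi * ‖x‖)| ≤ 3 * ν ∧ rootDisc ν (2 * Real.pi * ‖x‖) ≠ 0 ∧
      ∀ p q : ℂ, p = -((ν * (2 * Real.pi * ‖x‖) ^ 2 / 2 : ℝ) : ℂ) +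
          rootDisc ν (2 * Real.pi * ‖x‖) →
        q = -((ν * (2 * Real.pi * ‖x‖) ^ 2 / 2 : ℝ) : ℂ) - rootDisc ν (2 * Real.pi * ‖x‖) →
        Complex.exp (t * p) - Complex.exp (t * q) = (p - q) * E₁ ∧
        p * Complex.exp (t * q) - q * Complex.exp (t * p) = (p - q) * E₀ := by
    rcases lt_or_gt_of_ne hne with h | h
    · exact exists_propagators_of_lt hν hr h ht
    · exact exists_propagators_of_gt hν hr h ht
  obtain ⟨E₀, E₁, hE0, hE1, hne0, hid⟩ := hE
  obtain ⟨hid1, hid0⟩ := hid _ _ rfl rfl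
  simp only [Pi.neg_apply, Pi.add_apply, Pi.sub_apply] at hx
  rw [hid1, hid0] at hx
  have hpq : (-((ν * (2 * Real.pi * ‖x‖) ^ 2 / 2 : ℝ) : ℂ) + rootDisc ν (2 * Real.pi * ‖x‖)) -
      (-((ν * (2 * Real.pi * ‖x‖) ^ 2 / 2 : ℝ) : ℂ) - rootDisc ν (2 * Real.pi * ‖x‖)) ≠ 0 := by
    have : (2 : ℂ) * rootDisc ν (2 * Real.pi * ‖x‖) ≠ 0 := mul_ne_zero two_ne_zero hne0
    convert this using 1
    ring
  have hux : (𝓕 (u t) : L2 n) x = E₁ * (𝓕 u₁ : L2 n) x + E₀ * (𝓕 u₀ : L2 n) x := by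
    apply mul_left_cancel₀ hpq
    rw [hx]
    ring
  rw [e1, Pi.add_apply, e2, Pi.sub_apply, e3, hG, e4, hux]
  have hfin : E₁ * (𝓕 u₁ : L2 n) x + E₀ * (𝓕 u₀ : L2 n) x -
      (waveSymbol t x : ℂ) * (𝓕 u₁ : L2 n) x +
      (lowKernel ν t (2 * Real.pi * ‖x‖) : ℂ) * (𝓕 u₁ : L2 n) x =
      (E₀ : ℂ) * (𝓕 u₀ : L2 n) x +
      ((E₁ - waveSymbol t x + lowKernel ν t (2 * Real.pi * ‖x‖) : ℝ) : ℂ) *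
        (𝓕 u₁ : L2 n) x := by
    push_cast
    ring
  rw [hfin]
  refine (norm_add_le _ _).trans ?_
  rw [norm_mul, norm_mul, Complex.norm_real, Complex.norm_real, Real.norm_eq_abs,
    Real.norm_eq_abs]
  gcongr
  exact hE1

/-! ### The Fourier transform on `L¹ ∩ L²` -/

theorem continuous_fourierIntegral {f : Space n → ℂ} (hf : Integrable f volume) :
    Continuous (𝓕 f : Space n → ℂ) :=
  VectorFourier.fourierIntegral_continuous Real.continuous_fourierChar
    (L := innerₗ (Space n)) continuous_inner hf

/-- On `L¹ ∩ L²` the Fourier transform of `L²` is given by the Fourier integral. -/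
theorem fourier_ae_eq_fourierIntegral (f : L2 n) (hf : Integrable f volume) :
    (𝓕 f : L2 n) =ᵐ[volume] (𝓕 (f : Space n → ℂ) : Space n → ℂ) := by
  apply ae_eq_of_integral_contDiff_smul_eq
  · exact (Lp.memLp _).locallyIntegrable (by norm_num)
  · exact (continuous_fourierIntegral hf).locallyIntegrable
  · intro ψ hψ hψc
    have hg₁ : HasCompactSupport (Complex.ofRealCLM ∘ ψ) := hψc.comp_left rfl
    have hg₂ : ContDiff ℝ ((⊤ : ℕ∞) : WithTop ℕ∞) (Complex.ofRealCLM ∘ ψ) := by fun_prop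
    have h1 := distr_fourier f (hg₁.toSchwartzMap hg₂)
    rw [Lp.toTemperedDistribution_apply] at h1
    have h2 : ∫ ξ, 𝓕 (hg₁.toSchwartzMap hg₂) ξ • f ξ =
        ∫ x, (hg₁.toSchwartzMap hg₂) x • (𝓕 (f : Space n → ℂ) : Space n → ℂ) x := by
      simpa using! VectorFourier.integral_fourierIntegral_smul_eq_flip (L := innerₗ (Space n))
        Real.continuous_fourierChar continuous_inner (hg₁.toSchwartzMap hg₂).integrable hf
    rw [h2] at h1
    simpa using h1.symm

theorem norm_fourierIntegral_le (f : Space n → ℂ) (x : Space n) :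
    ‖(𝓕 f : Space n → ℂ) x‖ ≤ ∫ y, ‖f y‖ :=
  VectorFourier.norm_fourierIntegral_le_integral_norm _ _ _ _ _

theorem fourierIntegral_zero (f : Space n → ℂ) : (𝓕 f : Space n → ℂ) 0 = ∫ y, f y := by
  rw [Real.fourier_eq]
  simp

/-! ### Size of the kernel from above -/

/-- A rational majorant of `min(1, s)` type: with `s = ν r² t / 2` it cancels the `r⁻²` of the
kernel and has an elementary radial integral in both dimensions. -/
theorem one_sub_exp_neg_sq_le {s : ℝ} (hs : 0 ≤ s) :
    (1 - Real.exp (-s)) ^ 2 ≤ 2 * s / (1 + s) := by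
  obtain ⟨h0, h1⟩ := one_sub_exp_neg_mem hs
  have h2 := Real.add_one_le_exp (-s)
  rw [le_div_iff₀ (by linarith)]
  have h3 : (1 - Real.exp (-s)) ^ 2 ≤ 1 - Real.exp (-s) := by nlinarith
  have h4 : (1 - Real.exp (-s)) * (1 + s) ≤ 2 * s := by
    nlinarith
  nlinarith

theorem lowKernel_sq_le {ν t r : ℝ} (hν : 0 < ν) (ht : 0 ≤ t) (hr : 0 < r) :
    lowKernel ν t r ^ 2 ≤ ν * t / (1 + ν * t * r ^ 2 / 2) := by
  unfold lowKernel
  split_ifs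
  · have h := one_sub_exp_neg_sq_le (s := ν * r ^ 2 / 2 * t) (by positivity)
    have h2 : Real.sin (t * r) ^ 2 ≤ 1 := Real.sin_sq_le_one _
    calc ((1 - Real.exp (-(ν * r ^ 2 / 2 * t))) * Real.sin (t * r) / r) ^ 2
        = (1 - Real.exp (-(ν * r ^ 2 / 2 * t))) ^ 2 * Real.sin (t * r) ^ 2 / r ^ 2 := by ring
      _ ≤ (2 * (ν * r ^ 2 / 2 * t) / (1 + ν * r ^ 2 / 2 * t)) * 1 / r ^ 2 := by gcongr
      _ = ν * t / (1 + ν * t * r ^ 2 / 2) := by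
        field_simp
  · have : 0 ≤ ν * t / (1 + ν * t * r ^ 2 / 2) := by positivity
    simpa using this

theorem lowKernel_eq_zero {ν t r : ℝ} (h : 1 < ν * r) : lowKernel ν t r = 0 :=
  if_neg h.not_ge

theorem integrable_lowKernel_sq {ν t : ℝ} (hν : 0 < ν) (ht : 0 ≤ t) :
    Integrable (fun x : Space n => lowKernel ν t (2 * Real.pi * ‖x‖) ^ 2) volume := by
  have hπ := Real.pi_pos
  have hm : Measurable fun x : Space n => lowKernel ν t (2 * Real.pi * ‖x‖) ^ 2 :=
    ((measurable_lowKernel ν t).comp (by fun_prop)).pow_const 2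
  -- The kernel lives in `2π‖x‖ ≤ 1 / ν`; the larger radius `1 / ν` is enough.
  have hI : IntegrableOn (fun _ : Space n => t ^ 2) (Metric.closedBall 0 (1 / ν)) volume :=
    integrableOn_const measure_closedBall_lt_top.ne
  have hI' := (integrable_indicator_iff Metric.isClosed_closedBall.measurableSet).2 hI
  refine hI'.mono' hm.aestronglyMeasurable (Eventually.of_forall fun x => ?_)
  rw [Real.norm_of_nonneg (sq_nonneg _)]
  by_cases hx : x ∈ Metric.closedBall (0 : Space n) (1 / ν)
  · rw [Set.indicator_of_mem hx, ← sq_abs]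
    exact pow_le_pow_left₀ (abs_nonneg _) (abs_lowKernel_le hν ht (by positivity)) 2
  · rw [Set.indicator_of_notMem hx]
    have h1 : 1 / ν < ‖x‖ := by simpa using hx
    rw [div_lt_iff₀ hν] at h1
    rw [lowKernel_eq_zero]
    · simp
    · have h3 := Real.pi_gt_three
      have : ν * ‖x‖ * 1 ≤ ν * ‖x‖ * (2 * Real.pi) := by gcongr; linarith
      nlinarith

theorem integrableOn_Ioi_lowKernel_sq {ν t : ℝ} (hν : 0 < ν) (ht : 0 ≤ t)
    [Nontrivial (Space n)] :
    IntegrableOn (fun y : ℝ => y ^ (n - 1) * lowKernel ν t (2 * Real.pi * y) ^ 2)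
      (Set.Ioi 0) := by
  have h := (integrable_fun_norm_addHaar (volume : Measure (Space n))
    (f := fun y => lowKernel ν t (2 * Real.pi * y) ^ 2)).1 (integrable_lowKernel_sq hν ht)
  simpa using h

/-- The majorant is a Lorentzian of height `ν t` and width of order `t^(-1/2)`, whose area is of
order `√t`. -/
theorem integral_lowKernel_sq_dim_one_le {ν t : ℝ} (hν : 0 < ν) (ht : 0 < t) :
    ∫ x : Space 1, lowKernel ν t (2 * Real.pi * ‖x‖) ^ 2 ≤
      (volume : Measure (Space 1)).real (Metric.ball 0 1) * Real.sqrt (ν / 2) * Real.sqrt t := by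
  have hπ := Real.pi_pos
  rw [integral_fun_norm_addHaar (volume : Measure (Space 1))
    (fun y => lowKernel ν t (2 * Real.pi * y) ^ 2)]
  set c := 2 * Real.pi * Real.sqrt (ν * t / 2) with hc
  have hs : 0 < Real.sqrt (ν * t / 2) := Real.sqrt_pos.2 (by positivity)
  have hs2 : Real.sqrt (ν * t / 2) ^ 2 = ν * t / 2 := Real.sq_sqrt (by positivity)
  have hc0 : 0 < c := by positivity
  have hgi : Integrable fun y : ℝ => ν * t * (1 + (c * y) ^ 2)⁻¹ :=
    (integrable_inv_one_add_sq.comp_mul_left' hc0.ne').const_mul _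
  have h1 : ∫ y in Set.Ioi (0 : ℝ), y ^ (1 - 1) * lowKernel ν t (2 * Real.pi * y) ^ 2 ≤
      ∫ y in Set.Ioi (0 : ℝ), ν * t * (1 + (c * y) ^ 2)⁻¹ := by
    refine setIntegral_mono_on (integrableOn_Ioi_lowKernel_sq (n := 1) hν ht.le)
      hgi.integrableOn measurableSet_Ioi fun y hy => ?_
    have hy : 0 < y := hy
    have := lowKernel_sq_le hν ht.le (r := 2 * Real.pi * y) (by positivity)
    simp only [Nat.sub_self, pow_zero, one_mul]
    refine this.trans (le_of_eq ?_)
    rw [div_eq_mul_inv]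
    congr 3
    rw [hc]
    linear_combination (-4 * Real.pi ^ 2 * y ^ 2) * hs2
  have h2 : ∫ y in Set.Ioi (0 : ℝ), ν * t * (1 + (c * y) ^ 2)⁻¹ ≤
      ∫ y : ℝ, ν * t * (1 + (c * y) ^ 2)⁻¹ :=
    setIntegral_le_integral hgi (Eventually.of_forall fun y => by positivity)
  have h3 : ∫ y : ℝ, ν * t * (1 + (c * y) ^ 2)⁻¹ = Real.sqrt (ν / 2) * Real.sqrt t := by
    rw [integral_const_mul, Measure.integral_comp_mul_left (fun y : ℝ => (1 + y ^ 2)⁻¹) c,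
      integral_univ_inv_one_add_sq, abs_of_pos (inv_pos.2 hc0), ← Real.sqrt_mul (by positivity),
      smul_eq_mul, show ν / 2 * t = ν * t / 2 by ring]
    rw [hc]
    field_simp
    linarith
  simp only [finrank_euclideanSpace_fin, one_smul, smul_eq_mul]
  rw [mul_assoc]
  exact mul_le_mul_of_nonneg_left ((h1.trans h2).trans h3.le) measureReal_nonneg

/-- The polar weight `y` turns the majorant into a multiple of a logarithmic derivative. Its tail `1
/ y` is not integrable, so here the cutoff `ν r ≤ 1` is essential. -/
theorem integral_lowKernel_sq_dim_two_le {ν t : ℝ} (hν : 0 < ν) (ht : 0 < t) :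
    ∫ x : Space 2, lowKernel ν t (2 * Real.pi * ‖x‖) ^ 2 ≤
      2 * ((volume : Measure (Space 2)).real (Metric.ball 0 1) *
        (1 / (4 * Real.pi ^ 2) * Real.log (1 + t / (2 * ν)))) := by
  have hπ := Real.pi_pos
  rw [integral_fun_norm_addHaar (volume : Measure (Space 2))
    (fun y => lowKernel ν t (2 * Real.pi * y) ^ 2)]
  set R := 1 / (2 * Real.pi * ν) with hR
  have hR0 : 0 < R := by positivity
  have hcont : Continuous fun y : ℝ => ν * t * y / (1 + 2 * Real.pi ^ 2 * ν * t * y ^ 2) :=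
    Continuous.div (by fun_prop) (by fun_prop) fun y => by positivity
  have hgi : IntegrableOn
      ((Set.Ioc 0 R).indicator fun y : ℝ => ν * t * y / (1 + 2 * Real.pi ^ 2 * ν * t * y ^ 2))
      (Set.Ioi 0) := by
    refine Integrable.integrableOn ((integrable_indicator_iff measurableSet_Ioc).2 ?_)
    exact (hcont.integrableOn_Icc (a := 0) (b := R)).mono_set Set.Ioc_subset_Icc_self
  have h1 : ∫ y in Set.Ioi (0 : ℝ), y ^ (2 - 1) * lowKernel ν t (2 * Real.pi * y) ^ 2 ≤
      ∫ y in Set.Ioi (0 : ℝ), (Set.Ioc 0 R).indicator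
        (fun y : ℝ => ν * t * y / (1 + 2 * Real.pi ^ 2 * ν * t * y ^ 2)) y := by
    refine setIntegral_mono_on (integrableOn_Ioi_lowKernel_sq (n := 2) hν ht.le)
      hgi measurableSet_Ioi fun y hy => ?_
    have hy : 0 < y := hy
    rw [show 2 - 1 = 1 from rfl, pow_one]
    by_cases hyR : y ≤ R
    · rw [Set.indicator_of_mem (Set.mem_Ioc.2 ⟨hy, hyR⟩)]
      have := lowKernel_sq_le hν ht.le (r := 2 * Real.pi * y) (by positivity)
      calc _ ≤ y * (ν * t / (1 + ν * t * (2 * Real.pi * y) ^ 2 / 2)) := by gcongr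
        _ = _ := by
          rw [mul_div_assoc']
          congr 1 <;> ring
    · rw [Set.indicator_of_notMem (fun h => hyR h.2), lowKernel_eq_zero]
      · simp
      · rw [not_le, hR, div_lt_iff₀ (by positivity)] at hyR
        linarith
  have h2 : ∫ y in Set.Ioi (0 : ℝ), (Set.Ioc 0 R).indicator
        (fun y : ℝ => ν * t * y / (1 + 2 * Real.pi ^ 2 * ν * t * y ^ 2)) y =
      ∫ y in (0 : ℝ)..R, ν * t * y / (1 + 2 * Real.pi ^ 2 * ν * t * y ^ 2) := by
    rw [setIntegral_indicator measurableSet_Ioc,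
      Set.inter_eq_self_of_subset_right Set.Ioc_subset_Ioi_self,
      intervalIntegral.integral_of_le hR0.le]
  have h3 : ∫ y in (0 : ℝ)..R, ν * t * y / (1 + 2 * Real.pi ^ 2 * ν * t * y ^ 2) =
      1 / (4 * Real.pi ^ 2) * Real.log (1 + t / (2 * ν)) := by
    rw [intervalIntegral.integral_eq_sub_of_hasDerivAt
      (f := fun y => 1 / (4 * Real.pi ^ 2) * Real.log (1 + 2 * Real.pi ^ 2 * ν * t * y ^ 2))]
    · have : 2 * Real.pi ^ 2 * ν * t * R ^ 2 = t / (2 * ν) := by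
        rw [hR]; field_simp
      rw [this]
      simp
    · intro y _
      have hpos : 1 + 2 * Real.pi ^ 2 * ν * t * y ^ 2 ≠ 0 := by positivity
      have hd := (((hasDerivAt_pow 2 y).const_mul (2 * Real.pi ^ 2 * ν * t)).const_add
        1).log hpos
      refine (hd.const_mul (1 / (4 * Real.pi ^ 2))).congr_deriv ?_
      push_cast
      field_simp
      ring
    · exact hcont.intervalIntegrable _ _
  simp only [finrank_euclideanSpace_fin, nsmul_eq_mul, smul_eq_mul]
  push_cast
  gcongr
  exact h1.trans (h2.trans h3).le

/-! ### Size of the kernel from below in dimension two -/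

/-- Half of `1 / y` gives the logarithm; the oscillating half is integrated by parts. Using `1 -
sin` in the primitive instead of `-sin` gives the remainder a sign, so it can be dropped. -/
theorem integral_sin_sq_div_ge {τ y₀ η : ℝ} (hτ : 0 < τ) (hy : 0 < y₀) (hη : y₀ ≤ η) :
    1 / 2 * Real.log η - 1 / 2 * Real.log y₀ - 1 / (2 * τ * y₀) ≤
      ∫ y in y₀..η, Real.sin (τ * y) ^ 2 / y := by
  have hmem : ∀ y ∈ Set.uIcc y₀ η, 0 < y := fun y h => by
    rw [Set.uIcc_of_le hη] at h
    exact hy.trans_le h.1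
  let H : ℝ → ℝ := fun y => 1 / 2 * Real.log y + (1 - Real.sin (2 * τ * y)) / (4 * τ * y)
  let H' : ℝ → ℝ := fun y => Real.sin (τ * y) ^ 2 / y - (1 - Real.sin (2 * τ * y)) / (4 * τ * y ^ 2)
  have hH : ∀ y ∈ Set.uIcc y₀ η, HasDerivAt H (H' y) y := by
    intro y h
    have hy0 := hmem y h
    have h1 := (Real.hasDerivAt_log hy0.ne').const_mul (1 / 2)
    have h2 := ((((hasDerivAt_id y).const_mul (2 * τ)).sin.const_sub 1).div
      ((hasDerivAt_id y).const_mul (4 * τ)) (by simp [hτ.ne', hy0.ne']))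
    refine (h1.add h2).congr_deriv ?_
    simp only [H', id]
    have hc : Real.cos (2 * τ * y) = 1 - 2 * Real.sin (τ * y) ^ 2 := by
      rw [mul_assoc, Real.cos_two_mul, Real.cos_sq']
      ring
    rw [hc]
    field_simp
    ring
  have hHc : ContinuousOn H' (Set.uIcc y₀ η) := by
    refine ContinuousOn.sub (ContinuousOn.div (by fun_prop) (by fun_prop) fun y h =>
      (hmem y h).ne') (ContinuousOn.div (by fun_prop) (by fun_prop) fun y h => ?_)
    have := hmem y h
    positivity
  have hSc : ContinuousOn (fun y => Real.sin (τ * y) ^ 2 / y) (Set.uIcc y₀ η) :=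
    ContinuousOn.div (by fun_prop) (by fun_prop) fun y h => (hmem y h).ne'
  have hint := intervalIntegral.integral_eq_sub_of_hasDerivAt hH hHc.intervalIntegrable
  have hmono : ∫ y in y₀..η, H' y ≤ ∫ y in y₀..η, Real.sin (τ * y) ^ 2 / y := by
    refine intervalIntegral.integral_mono_on hη hHc.intervalIntegrable hSc.intervalIntegrable
      fun y h => ?_
    have hy0 := hy.trans_le h.1
    have : 0 ≤ (1 - Real.sin (2 * τ * y)) / (4 * τ * y ^ 2) :=
      div_nonneg (by linarith [Real.sin_le_one (2 * τ * y)]) (by positivity)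
    simp only [H']
    linarith
  have h1 : 0 ≤ (1 - Real.sin (2 * τ * η)) / (4 * τ * η) :=
    div_nonneg (by linarith [Real.sin_le_one (2 * τ * η)])
      (by have := hy.trans_le hη; positivity)
  have h2 : (1 - Real.sin (2 * τ * y₀)) / (4 * τ * y₀) ≤ 1 / (2 * τ * y₀) := by
    rw [div_le_div_iff₀ (by positivity) (by positivity)]
    have : 0 < 2 * τ * y₀ := by positivity
    nlinarith [Real.neg_one_le_sin (2 * τ * y₀)]
  rw [hint] at hmono
  simp only [H] at hmono
  linarith

/-- On `1 ≤ t r² ` with `ν r ≤ 1` the kernel is bounded below by that of the free wave. -/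
theorem lowKernel_sq_ge {ν t r : ℝ} (hν : 0 < ν) (hνr : ν * r ≤ 1)
    (hrt : 1 ≤ t * r ^ 2) :
    (1 - Real.exp (-(ν / 2))) ^ 2 * (Real.sin (t * r) ^ 2 / r ^ 2) ≤ lowKernel ν t r ^ 2 := by
  rw [lowKernel, if_pos hνr, mul_div_assoc, mul_pow, div_pow]
  have h0 := (one_sub_exp_neg_mem (s := ν / 2) (by positivity)).1
  gcongr
  nlinarith

/-- On the window `t^(-1/2) ≤ r ≤ 2πη` the damping factor is at least `1 - exp(-ν / 2)`, and `sin² /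
r²` with the polar weight integrates to half the logarithmic length of the window, up to a boundary
term. -/
theorem setIntegral_lowKernel_sq_dim_two_ge {ν t η : ℝ} (hν : 0 < ν) (ht : 0 < t)
    (hην : ν * (2 * Real.pi * η) ≤ 1) (hηt : 1 ≤ Real.sqrt t * (2 * Real.pi * η)) :
    2 * ((volume : Measure (Space 2)).real (Metric.ball 0 1) *
      ((1 - Real.exp (-(ν / 2))) ^ 2 / (4 * Real.pi ^ 2) *
        (1 / 4 * Real.log t + 1 / 2 * Real.log (2 * Real.pi * η) - 1 / (2 * Real.sqrt t)))) ≤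
    ∫ x in Metric.ball (0 : Space 2) η, lowKernel ν t (2 * Real.pi * ‖x‖) ^ 2 := by
  have hπ := Real.pi_pos
  have hst : 0 < Real.sqrt t := Real.sqrt_pos.2 ht
  have hst2 : Real.sqrt t ^ 2 = t := Real.sq_sqrt ht.le
  have hη0 : 0 < η := by
    by_contra h
    have : Real.sqrt t * (2 * Real.pi * η) ≤ 0 :=
      mul_nonpos_of_nonneg_of_nonpos hst.le
        (mul_nonpos_of_nonneg_of_nonpos (by positivity) (not_lt.1 h))
    linarith
  have hball : ∫ x in Metric.ball (0 : Space 2) η, lowKernel ν t (2 * Real.pi * ‖x‖) ^ 2 =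
      ∫ x : Space 2, (Set.Iio η).indicator
        (fun y => lowKernel ν t (2 * Real.pi * y) ^ 2) ‖x‖ := by
    rw [← integral_indicator measurableSet_ball]
    refine integral_congr_ae (Eventually.of_forall fun x => ?_)
    simp [Set.indicator]
  rw [hball, integral_fun_norm_addHaar (volume : Measure (Space 2))]
  simp only [finrank_euclideanSpace_fin, nsmul_eq_mul, smul_eq_mul]
  push_cast
  set y₀ := 1 / (2 * Real.pi * Real.sqrt t) with hy₀
  have hy₀0 : 0 < y₀ := by positivity
  have hy₀η : y₀ ≤ η := by
    rw [hy₀, div_le_iff₀ (by positivity)]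
    linarith
  have hsin := integral_sin_sq_div_ge (τ := 2 * Real.pi * t) (by positivity) hy₀0 hy₀η
  have hlog : Real.log y₀ = -(Real.log (2 * Real.pi) + 1 / 2 * Real.log t) := by
    rw [hy₀, one_div, Real.log_inv, Real.log_mul (by positivity) hst.ne',
      Real.log_sqrt ht.le]
    ring
  have hlogη : Real.log (2 * Real.pi * η) = Real.log (2 * Real.pi) + Real.log η :=
    Real.log_mul (by positivity) hη0.ne'
  have hlast : 1 / (2 * (2 * Real.pi * t) * y₀) = 1 / (2 * Real.sqrt t) := by
    rw [hy₀]
    congr 1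
    field_simp
    rw [hst2]
  have hsin' : 1 / 4 * Real.log t + 1 / 2 * Real.log (2 * Real.pi * η) - 1 / (2 * Real.sqrt t) ≤
      ∫ y in y₀..η, Real.sin (2 * Real.pi * t * y) ^ 2 / y := by
    rw [hlast, hlog] at hsin
    rw [hlogη]
    linarith
  have hi : IntegrableOn (fun y : ℝ => y ^ (2 - 1) * (Set.Iio η).indicator
      (fun y => lowKernel ν t (2 * Real.pi * y) ^ 2) y) (Set.Ioi 0) := by
    have h := (integrableOn_Ioi_lowKernel_sq (n := 2) hν ht.le).indicator
      (measurableSet_Iio (a := η))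
    refine h.congr (Eventually.of_forall fun y => ?_)
    simp [Set.indicator]
  have hle : (1 - Real.exp (-(ν / 2))) ^ 2 / (4 * Real.pi ^ 2) *
      (∫ y in y₀..η, Real.sin (2 * Real.pi * t * y) ^ 2 / y) ≤
      ∫ y in Set.Ioi (0 : ℝ), y ^ (2 - 1) * (Set.Iio η).indicator
        (fun y => lowKernel ν t (2 * Real.pi * y) ^ 2) y := by
    rw [← intervalIntegral.integral_const_mul, intervalIntegral.integral_of_le hy₀η,
      integral_Ioc_eq_integral_Ioo]
    have hsub : Set.Ioo y₀ η ⊆ Set.Ioi 0 := fun y h => hy₀0.trans h.1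
    refine le_trans ?_ (setIntegral_mono_set hi ?_ hsub.eventuallyLE)
    · refine setIntegral_mono_on ?_ (hi.mono_set hsub) measurableSet_Ioo fun y h => ?_
      · have hc : ContinuousOn (fun y => (1 - Real.exp (-(ν / 2))) ^ 2 / (4 * Real.pi ^ 2) *
            (Real.sin (2 * Real.pi * t * y) ^ 2 / y)) (Set.Icc y₀ η) := by
          refine continuousOn_const.mul (ContinuousOn.div (by fun_prop) (by fun_prop) fun y h => ?_)
          exact (hy₀0.trans_le h.1).ne'
        exact hc.integrableOn_Icc.mono_set Set.Ioo_subset_Icc_self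
      · have hy0 : 0 < y := hy₀0.trans h.1
        rw [Set.indicator_of_mem (Set.mem_Iio.2 h.2), show 2 - 1 = 1 from rfl, pow_one]
        have h1 : ν * (2 * Real.pi * y) ≤ 1 := by
          refine le_trans ?_ hην
          have := h.2.le
          gcongr
        have h2 : 1 ≤ t * (2 * Real.pi * y) ^ 2 := by
          have h3 : 1 ≤ Real.sqrt t * (2 * Real.pi * y) := by
            have := h.1
            rw [hy₀, div_lt_iff₀ (by positivity)] at this
            linarith
          calc 1 ≤ (Real.sqrt t * (2 * Real.pi * y)) ^ 2 := one_le_pow₀ h3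
            _ = t * (2 * Real.pi * y) ^ 2 := by rw [mul_pow, hst2]
        have h3 := lowKernel_sq_ge hν h1 h2
        calc _ = y * ((1 - Real.exp (-(ν / 2))) ^ 2 *
              (Real.sin (t * (2 * Real.pi * y)) ^ 2 / (2 * Real.pi * y) ^ 2)) := by
              rw [show 2 * Real.pi * t * y = t * (2 * Real.pi * y) by ring]
              field_simp
              ring
          _ ≤ _ := by gcongr
    · refine (ae_restrict_iff' measurableSet_Ioi).2 (Eventually.of_forall fun y hy => ?_)
      have hy : 0 < y := hy
      exact mul_nonneg (by positivity) (Set.indicator_nonneg (fun _ _ => sq_nonneg _) _)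
  refine mul_le_mul_of_nonneg_left (mul_le_mul_of_nonneg_left ?_ measureReal_nonneg) two_pos.le
  exact (mul_le_mul_of_nonneg_left hsin' (by positivity)).trans hle

/-! ### The kernel applied to the data -/

theorem L2_norm_sq_eq_integral (f : L2 n) : ‖f‖ ^ 2 = ∫ x, ‖f x‖ ^ 2 := by
  have h := L2.inner_def (𝕜 := ℂ) f f
  simp only [inner_self_eq_norm_sq_to_K] at h
  have h2 : ((∫ x, ‖f x‖ ^ 2 : ℝ) : ℂ) = ∫ x, ((‖f x‖ : ℝ) : ℂ) ^ 2 := by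
    rw [← integral_complex_ofReal]
    push_cast
    rfl
  apply Complex.ofReal_injective
  rw [h2]
  push_cast
  exact h

theorem L2_integrable_norm_sq (f : L2 n) : Integrable (fun x => ‖f x‖ ^ 2) volume :=
  (Lp.memLp f).integrable_norm_pow two_ne_zero

/-- The low frequency kernel applied to `û₁` is controlled by `‖u₁‖_{L¹}`. -/
theorem norm_lowKernel_mul_le {ν t : ℝ} (hν : 0 < ν) (ht : 0 ≤ t) (f : L2 n)
    (hf : Integrable f volume) :
    ‖(memLp_lowKernel_mul hν ht (𝓕 f : L2 n)).toLp‖ ≤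
      Real.sqrt (∫ x : Space n, lowKernel ν t (2 * Real.pi * ‖x‖) ^ 2) * ∫ x, ‖f x‖ := by
  set M := ∫ x, ‖f x‖ with hM
  have hM0 : 0 ≤ M := integral_nonneg fun _ => norm_nonneg _
  set I := ∫ x : Space n, lowKernel ν t (2 * Real.pi * ‖x‖) ^ 2 with hI
  have hI0 : 0 ≤ I := integral_nonneg fun _ => sq_nonneg _
  refine abs_le_of_sq_le_sq' ?_ (by positivity) |>.2
  rw [mul_pow, Real.sq_sqrt hI0, L2_norm_sq_eq_integral, hI, ← integral_mul_const]
  refine integral_mono_ae (L2_integrable_norm_sq _)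
    ((integrable_lowKernel_sq hν ht).mul_const _) ?_
  filter_upwards [(memLp_lowKernel_mul hν ht (𝓕 f : L2 n)).coeFn_toLp,
    fourier_ae_eq_fourierIntegral f hf] with x h1 h2
  rw [h1, h2, norm_mul, Complex.norm_real, Real.norm_eq_abs, mul_pow, sq_abs]
  have := norm_fourierIntegral_le (f : Space n → ℂ) x
  gcongr

/-- Near frequency zero `û₁` is comparable to the mass of `u₁`. -/
theorem norm_lowKernel_mul_ge {ν t η : ℝ} (hν : 0 < ν) (ht : 0 ≤ t) (f : L2 n)
    (hf : Integrable f volume)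
    (hη : ∀ x ∈ Metric.ball (0 : Space n) η, ‖∫ y, f y‖ / 2 ≤ ‖(𝓕 (f : Space n → ℂ)) x‖) :
    ‖∫ y, f y‖ / 2 * Real.sqrt (∫ x in Metric.ball (0 : Space n) η,
        lowKernel ν t (2 * Real.pi * ‖x‖) ^ 2) ≤
      ‖(memLp_lowKernel_mul hν ht (𝓕 f : L2 n)).toLp‖ := by
  set I := ∫ x in Metric.ball (0 : Space n) η, lowKernel ν t (2 * Real.pi * ‖x‖) ^ 2 with hI
  have hI0 : 0 ≤ I := integral_nonneg fun _ => sq_nonneg _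
  refine abs_le_of_sq_le_sq' ?_ (norm_nonneg _) |>.2
  rw [mul_pow, Real.sq_sqrt hI0, L2_norm_sq_eq_integral, hI, ← integral_const_mul]
  refine le_trans ?_ (setIntegral_le_integral (s := Metric.ball (0 : Space n) η)
    (L2_integrable_norm_sq _) (Eventually.of_forall fun _ => sq_nonneg _))
  refine setIntegral_mono_on_ae ((integrable_lowKernel_sq hν ht).integrableOn.const_mul _)
    (L2_integrable_norm_sq _).integrableOn measurableSet_ball ?_
  filter_upwards [(memLp_lowKernel_mul hν ht (𝓕 f : L2 n)).coeFn_toLp,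
    fourier_ae_eq_fourierIntegral f hf] with x h1 h2 hx
  rw [h1, h2, norm_mul, Complex.norm_real, Real.norm_eq_abs, mul_pow, sq_abs, mul_comm]
  have := hη x hx
  gcongr

theorem exists_radius_half_mass_le {f : Space n → ℂ} (hf : Integrable f volume)
    (hm : ∫ y, f y ≠ 0) :
    ∃ δ > 0, ∀ x ∈ Metric.ball (0 : Space n) δ, ‖∫ y, f y‖ / 2 ≤ ‖(𝓕 f : Space n → ℂ) x‖ := by
  have hpos : 0 < ‖∫ y, f y‖ := norm_pos_iff.2 hm
  have hc := (continuous_fourierIntegral hf).norm.continuousAt (x := (0 : Space n))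
  have hev : ∀ᶠ x in 𝓝 (0 : Space n), ‖∫ y, f y‖ / 2 < ‖(𝓕 f : Space n → ℂ) x‖ := by
    refine hc.eventually_const_lt ?_
    simp only [fourierIntegral_zero]
    linarith
  obtain ⟨δ, hδ, h⟩ := Metric.eventually_nhds_iff_ball.1 hev
  exact ⟨δ, hδ, fun x hx => (h x hx).le⟩

/-! ### The final estimates -/

theorem sqrt_sqrt_eq_rpow {t : ℝ} (ht : 0 ≤ t) : Real.sqrt (Real.sqrt t) = t ^ (1 / 4 : ℝ) := by
  rw [Real.sqrt_eq_rpow, Real.sqrt_eq_rpow, ← Real.rpow_mul ht]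
  norm_num

/-- Upper bound in dimension one. -/
theorem upper_bound_dim_one {ν : ℝ} (hν : 0 < ν) : ∃ C : ℝ, 0 < C ∧
    ∀ (u₀ u₁ : L2 1) (u : ℝ → L2 1), Integrable u₁ volume → IsSolution ν u₀ u₁ u →
      ∀ t : ℝ, 2 ≤ t → ‖u t - freeWave t u₁‖ ≤
        C * ‖u₀‖ + C * t ^ (1 / 4 : ℝ) * (∫ x, ‖u₁ x‖) + C * ‖u₁‖ := by
  set B := (volume : Measure (Space 1)).real (Metric.ball 0 1) * Real.sqrt (ν / 2) with hB
  have hB0 : 0 ≤ B := mul_nonneg measureReal_nonneg (Real.sqrt_nonneg _)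
  refine ⟨3 + 3 * ν + Real.sqrt B, by positivity, fun u₀ u₁ u hu₁ hu t ht => ?_⟩
  have ht0 : 0 < t := by linarith
  have h1 := (abs_le.1 (hu.abs_norm_sub_freeWave_sub_le hν ht0.le)).2
  have h2 := norm_lowKernel_mul_le hν ht0.le u₁ hu₁
  have h3 : Real.sqrt (∫ x : Space 1, lowKernel ν t (2 * Real.pi * ‖x‖) ^ 2) ≤
      Real.sqrt B * t ^ (1 / 4 : ℝ) := by
    rw [← sqrt_sqrt_eq_rpow ht0.le, ← Real.sqrt_mul hB0]
    exact Real.sqrt_le_sqrt (integral_lowKernel_sq_dim_one_le hν ht0)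
  have hM0 : 0 ≤ ∫ x, ‖u₁ x‖ := integral_nonneg fun _ => norm_nonneg _
  have h4 := mul_le_mul_of_nonneg_right h3 hM0
  have h5 : 0 ≤ (3 * ν + Real.sqrt B) * ‖u₀‖ := by positivity
  have h6 : 0 ≤ (3 + 3 * ν) * t ^ (1 / 4 : ℝ) * ∫ x, ‖u₁ x‖ := by positivity
  have h7 : 0 ≤ (3 + Real.sqrt B) * ‖u₁‖ := by positivity
  linarith

/-- Upper bound in dimension two. -/
theorem upper_bound_dim_two {ν : ℝ} (hν : 0 < ν) : ∃ C : ℝ, 0 < C ∧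
    ∀ (u₀ u₁ : L2 2) (u : ℝ → L2 2), Integrable u₁ volume → IsSolution ν u₀ u₁ u →
      ∀ t : ℝ, 2 ≤ t → ‖u t - freeWave t u₁‖ ≤
        C * ‖u₀‖ + C * Real.sqrt (Real.log t) * (∫ x, ‖u₁ x‖) + C * ‖u₁‖ := by
  have hlog2 : 0 < Real.log 2 := Real.log_pos one_lt_two
  have hlogν : 0 ≤ Real.log (1 + 1 / (2 * ν)) := Real.log_nonneg (by
    have : 0 < 1 / (2 * ν) := by positivity
    linarith)
  set B := 2 * ((volume : Measure (Space 2)).real (Metric.ball 0 1) * (1 / (4 * Real.pi ^ 2) *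
    (1 + Real.log (1 + 1 / (2 * ν)) / Real.log 2))) with hB
  have hB0 : 0 ≤ B := by
    have : 0 ≤ (volume : Measure (Space 2)).real (Metric.ball 0 1) := measureReal_nonneg
    positivity
  refine ⟨3 + 3 * ν + Real.sqrt B, by positivity, fun u₀ u₁ u hu₁ hu t ht => ?_⟩
  have ht0 : 0 < t := by linarith
  have h1 := (abs_le.1 (hu.abs_norm_sub_freeWave_sub_le hν ht0.le)).2
  have h2 := norm_lowKernel_mul_le hν ht0.le u₁ hu₁
  -- The additive constant is absorbed into `log t` through `log 2 ≤ log t`.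
  have hlog : Real.log (1 + t / (2 * ν)) ≤
      (1 + Real.log (1 + 1 / (2 * ν)) / Real.log 2) * Real.log t := by
    have e1 : Real.log (1 + t / (2 * ν)) ≤ Real.log (t * (1 + 1 / (2 * ν))) := by
      refine Real.log_le_log (by positivity) ?_
      have : t * (1 + 1 / (2 * ν)) = t + t / (2 * ν) := by ring
      linarith
    have e2 : Real.log 2 ≤ Real.log t := Real.log_le_log two_pos ht
    have e3 : Real.log (1 + 1 / (2 * ν)) / Real.log 2 * Real.log 2 ≤
      Real.log (1 + 1 / (2 * ν)) / Real.log 2 * Real.log t := by gcongr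
    rw [div_mul_cancel₀ _ hlog2.ne'] at e3
    rw [Real.log_mul ht0.ne' (by positivity)] at e1
    linarith
  have h3 : Real.sqrt (∫ x : Space 2, lowKernel ν t (2 * Real.pi * ‖x‖) ^ 2) ≤
      Real.sqrt B * Real.sqrt (Real.log t) := by
    rw [← Real.sqrt_mul hB0]
    refine Real.sqrt_le_sqrt ((integral_lowKernel_sq_dim_two_le hν ht0).trans ?_)
    rw [hB, mul_assoc, mul_assoc, mul_assoc]
    have : 0 ≤ (volume : Measure (Space 2)).real (Metric.ball 0 1) := measureReal_nonneg
    gcongr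
  have hM0 : 0 ≤ ∫ x, ‖u₁ x‖ := integral_nonneg fun _ => norm_nonneg _
  have h4 := mul_le_mul_of_nonneg_right h3 hM0
  have h5 : 0 ≤ (3 * ν + Real.sqrt B) * ‖u₀‖ := by positivity
  have h6 : 0 ≤ (3 + 3 * ν) * Real.sqrt (Real.log t) * ∫ x, ‖u₁ x‖ := by positivity
  have h7 : 0 ≤ (3 + Real.sqrt B) * ‖u₁‖ := by positivity
  linarith

/-- Lower bound in dimension two. -/
theorem lower_bound_dim_two {ν : ℝ} (hν : 0 < ν) : ∃ c : ℝ, 0 < c ∧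
    ∀ (u₀ u₁ : L2 2) (u : ℝ → L2 2), Integrable u₁ volume → (∫ x, u₁ x) ≠ 0 →
      IsSolution ν u₀ u₁ u → ∀ᶠ t : ℝ in atTop,
        c * ‖∫ x, u₁ x‖ * Real.sqrt (Real.log t) ≤ ‖u t - freeWave t u₁‖ := by
  have hπ := Real.pi_pos
  have hvol : 0 < (volume : Measure (Space 2)).real (Metric.ball 0 1) :=
    ENNReal.toReal_pos (Metric.measure_ball_pos _ _ one_pos).ne' measure_ball_lt_top.ne
  have hκ : 0 < 1 - Real.exp (-(ν / 2)) := by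
    have : Real.exp (-(ν / 2)) < 1 := by
      rw [Real.exp_lt_one_iff]
      linarith
    linarith
  set A := 2 * ((volume : Measure (Space 2)).real (Metric.ball 0 1) *
    ((1 - Real.exp (-(ν / 2))) ^ 2 / (4 * Real.pi ^ 2))) with hA
  have hA0 : 0 < A := by positivity
  -- Half of the coefficient `1/4` of `log t` absorbs the constants, giving `A / 8`. The bound `|û₁|
  -- ≥ |m₁| / 2` costs a factor 2, and the data terms another.
  refine ⟨Real.sqrt (A / 8) / 4, by positivity, fun u₀ u₁ u hu₁ hm hu => ?_⟩
  have hmpos : 0 < ‖∫ x, u₁ x‖ := norm_pos_iff.2 hm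
  obtain ⟨δ, hδ, hδm⟩ := exists_radius_half_mass_le hu₁ hm
  -- `η` depends on `u₁`, but it enters only through how large `t` must be, so `c` depends on `ν`
  -- alone.
  set η := min δ (1 / (2 * Real.pi * ν)) with hη
  have hη0 : 0 < η := lt_min hδ (by positivity)
  have hην : ν * (2 * Real.pi * η) ≤ 1 := by
    have : η ≤ 1 / (2 * Real.pi * ν) := min_le_right _ _
    rw [le_div_iff₀ (by positivity)] at this
    linarith
  have hlogt := Real.tendsto_log_atTop
  have hsqrt := Real.tendsto_sqrt_atTop
  -- Besides `t ≥ 1`: the frequency window is nonempty, `log t` dominates `log (2πη)`, and `√(log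
  -- t)` dominates the data terms.
  filter_upwards [eventually_ge_atTop 1,
    hsqrt.eventually_ge_atTop (1 / (2 * Real.pi * η)),
    hlogt.eventually_ge_atTop (8 * (1 / 2 - 1 / 2 * Real.log (2 * Real.pi * η))),
    (hsqrt.comp hlogt).eventually_ge_atTop
      ((3 * ‖u₀‖ + 3 * ν * ‖u₁‖) / (Real.sqrt (A / 8) / 4 * ‖∫ x, u₁ x‖))] with t ht h1 h2 h3
  have ht0 : 0 < t := by linarith
  have hlog0 : 0 ≤ Real.log t := Real.log_nonneg ht
  have hst : 1 ≤ Real.sqrt t := Real.one_le_sqrt.2 ht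
  rw [div_le_iff₀ (by positivity)] at h1
  have hI := setIntegral_lowKernel_sq_dim_two_ge hν ht0 hην h1
  have hI2 : A / 8 * Real.log t ≤
      ∫ x in Metric.ball (0 : Space 2) η, lowKernel ν t (2 * Real.pi * ‖x‖) ^ 2 := by
    refine le_trans ?_ hI
    have hinv : 1 / (2 * Real.sqrt t) ≤ 1 / 2 := by
      rw [div_le_div_iff₀ (by positivity) two_pos]
      linarith
    calc A / 8 * Real.log t = A * (1 / 8 * Real.log t) := by ring
      _ ≤ A * (1 / 4 * Real.log t + 1 / 2 * Real.log (2 * Real.pi * η) -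
            1 / (2 * Real.sqrt t)) := by
          gcongr
          linarith
      _ = _ := by rw [hA]; ring
  have hG := norm_lowKernel_mul_ge hν ht0.le u₁ hu₁ (η := η)
    fun x hx => hδm x (Metric.ball_subset_ball (min_le_left _ _) hx)
  have hsq : Real.sqrt (A / 8) * Real.sqrt (Real.log t) ≤
      Real.sqrt (∫ x in Metric.ball (0 : Space 2) η,
        lowKernel ν t (2 * Real.pi * ‖x‖) ^ 2) := by
    rw [← Real.sqrt_mul (by positivity)]
    exact Real.sqrt_le_sqrt hI2
  have hG2 : ‖∫ x, u₁ x‖ / 2 * (Real.sqrt (A / 8) * Real.sqrt (Real.log t)) ≤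
      ‖(memLp_lowKernel_mul hν ht0.le (𝓕 u₁ : L2 2)).toLp‖ :=
    le_trans (by gcongr) hG
  have hcmp := (abs_le.1 (hu.abs_norm_sub_freeWave_sub_le hν ht0.le)).1
  rw [Function.comp_apply, div_le_iff₀ (by positivity)] at h3
  linarith

end StronglyDampedWave

end

theorem corollary1p3 (ν : ℝ) (hν : 0 < ν) :
    (∃ C : ℝ, 0 < C ∧
      ∀ (u₀ u₁ : StronglyDampedWave.L2 1) (u : ℝ → StronglyDampedWave.L2 1),
        StronglyDampedWave.MemH1 u₀ → Integrable u₁ volume →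
        StronglyDampedWave.IsSolution ν u₀ u₁ u →
        ∀ t : ℝ, 2 ≤ t →
          ‖u t - StronglyDampedWave.freeWave t u₁‖ ≤
            C * ‖u₀‖ + C * t ^ (1 / 4 : ℝ) * (∫ x, ‖u₁ x‖) + C * ‖u₁‖) ∧
    (∃ c C : ℝ, 0 < c ∧ 0 < C ∧
      ∀ (u₀ u₁ : StronglyDampedWave.L2 2) (u : ℝ → StronglyDampedWave.L2 2),
        StronglyDampedWave.MemH1 u₀ → Integrable u₁ volume → (∫ x, u₁ x) ≠ 0 →
        StronglyDampedWave.IsSolution ν u₀ u₁ u →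
        ∃ T : ℝ, 2 ≤ T ∧ ∀ t : ℝ, T ≤ t →
          c * ‖∫ x, u₁ x‖ * Real.sqrt (Real.log t) ≤
              ‖u t - StronglyDampedWave.freeWave t u₁‖ ∧
          ‖u t - StronglyDampedWave.freeWave t u₁‖ ≤
            C * ‖u₀‖ + C * Real.sqrt (Real.log t) * (∫ x, ‖u₁ x‖) + C * ‖u₁‖) := by
  obtain ⟨C₁, hC₁, h₁⟩ := StronglyDampedWave.upper_bound_dim_one hν
  obtain ⟨C₂, hC₂, h₂⟩ := StronglyDampedWave.upper_bound_dim_two hν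
  obtain ⟨c, hc, h₃⟩ := StronglyDampedWave.lower_bound_dim_two hν
  refine ⟨⟨C₁, hC₁, fun u₀ u₁ u _ hu₁ hu => h₁ u₀ u₁ u hu₁ hu⟩,
    ⟨c, C₂, hc, hC₂, fun u₀ u₁ u _ hu₁ hm hu => ?_⟩⟩
  obtain ⟨T, hT⟩ := eventually_atTop.1 (h₃ u₀ u₁ u hu₁ hm hu)
  exact ⟨max 2 T, le_max_left _ _, fun t ht => ⟨hT t ((le_max_right _ _).trans ht),
    h₂ u₀ u₁ u hu₁ hu t ((le_max_left _ _).trans ht)⟩⟩
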